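/- Let $n\ge 3$, let $I\subset\mathbb{R}$ be an open interval, let $h\colon I\to(0,\infty)$ be a smooth function, and let $(N,\bar g)$ be a smooth Riemannian manifold of dimension $n-1$. Let $g=dt\otimes dt+h(t)^2\,\bar g$ be the warped product metric on the $n$-dimensional manifold $I\times_h N=I\times N$, and put $\xi=h\,\frac{\partial}{\partial t}$; regard $h$ and its derivative $\dot h$ as functions on $I\times N$ depending only on $t$. For a smooth function $f$ on $I\times N$ let $$\mathcal{L}_g^{*}f=\nabla^2 f-(\Delta f)\,g-f\,\mathrm{Ric},$$ where $\nabla^2$, $\Delta=\mathrm{tr}_g\nabla^2$ and $\mathrm{Ric}$ are the Hessian, the Laplace–Beltrami operator and the Ricci tensor of $g$. Let $\mathrm{R}$ be the scalar curvature of $g$, let $\mathrm{A}=\mathrm{Ric}-\frac{\mathrm{R}}{2(n-1)}\,g$ be the Schouten tensor, and let $\mathrm{C}$ be the Cotton tensor, $\mathrm{C}(X,Y,Z)=(\nabla_Z\mathrm{A})(X,Y)-(\nabla_Y\mathrm{A})(X,Z)$. Suppose that $\mathrm{R}$ is constant on $I\times N$. Then, at every point $(t,x)$ of $I\times N$: 1.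 for all tangent vectors $X,Y$ of $I\times N$ at $(t,x)$, $$\mathcal{L}_g^{*}\dot h\,(X,Y)=-\mathrm{C}(X,\xi,Y);$$ 2. for all vectors $X,Y\in T_xN$ tangent to the fiber, $$\mathcal{L}_g^{*}\dot h\,(X,Y)=-\dot h(t)\,\mathring{\overline{\mathrm{Ric}}}(X,Y),\qquad \mathring{\overline{\mathrm{Ric}}}=\overline{\mathrm{Ric}}-\frac{\overline{\mathrm{R}}}{n-1}\,\bar g,$$ where $\overline{\mathrm{Ric}}$ and $\overline{\mathrm{R}}$ are the Ricci tensor and the scalar curvature of $\bar g$. -/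

import Mathlib

open scoped Manifold ContDiff

noncomputable section

/-! ## Tensor calculus in local coordinates

`E` is a finite-dimensional real vector space with a basis `b`; the coordinates on an open subset
of `E` are those of `b`.  A metric is given by its components `G y i j = g_ij(y)`. -/

namespace RiemCoord

variable {ι E : Type*} [Fintype ι] [DecidableEq ι] [NormedAddCommGroup E] [NormedSpace ℝ E]

/-- The partial derivative `∂_i u` at `y`. -/
def pd (b : Module.Basis ι ℝ E) (i : ι) (u : E → ℝ) (y : E) : ℝ :=
  fderiv ℝ u y (b i)

/-- The components `g^{ij}` of the inverse metric. -/
def invMetric (G : E → Matrix ι ι ℝ) (y : E) : Matrix ι ι ℝ :=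
  (G y)⁻¹

/-- The Christoffel symbol
`Γ^k_{ij} = (1/2) g^{kl} (∂_i g_{jl} + ∂_j g_{il} - ∂_l g_{ij})`. -/
def christoffel (b : Module.Basis ι ℝ E) (G : E → Matrix ι ι ℝ) (k i j : ι) (y : E) : ℝ :=
  (1 / 2) * ∑ l, invMetric G y k l *
    (pd b i (fun z => G z j l) y + pd b j (fun z => G z i l) y - pd b l (fun z => G z i j) y)

/-- The `∂_l`-component of `R(∂_i, ∂_j) ∂_k`, where
`R(X, Y) Z = ∇_X ∇_Y Z - ∇_Y ∇_X Z - ∇_{[X, Y]} Z`. -/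
def riemann (b : Module.Basis ι ℝ E) (G : E → Matrix ι ι ℝ) (l i j k : ι) (y : E) : ℝ :=
  pd b i (christoffel b G l j k) y - pd b j (christoffel b G l i k) y
    + ∑ s, (christoffel b G l i s y * christoffel b G s j k y
      - christoffel b G l j s y * christoffel b G s i k y)

/-- The Ricci tensor `R_{jk}`, the trace of `X ↦ R(X, ∂_j) ∂_k`. -/
def ricci (b : Module.Basis ι ℝ E) (G : E → Matrix ι ι ℝ) (j k : ι) (y : E) : ℝ :=
  ∑ i, riemann b G i i j k y

/-- The scalar curvature `g^{ij} R_{ij}`. -/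
def scalar (b : Module.Basis ι ℝ E) (G : E → Matrix ι ι ℝ) (y : E) : ℝ :=
  ∑ i, ∑ j, invMetric G y i j * ricci b G i j y

/-- The Hessian `∇²u(∂_i, ∂_j) = ∂_i ∂_j u - Γ^k_{ij} ∂_k u`. -/
def hessian (b : Module.Basis ι ℝ E) (G : E → Matrix ι ι ℝ) (u : E → ℝ) (i j : ι) (y : E) : ℝ :=
  pd b i (pd b j u) y - ∑ k, christoffel b G k i j y * pd b k u y

/-- The Laplace-Beltrami operator `Δu = g^{ij} ∇²u(∂_i, ∂_j)`. -/
def laplacian (b : Module.Basis ι ℝ E) (G : E → Matrix ι ι ℝ) (u : E → ℝ) (y : E) : ℝ :=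
  ∑ i, ∑ j, invMetric G y i j * hessian b G u i j y

/-- The covariant derivative
`T_{ij,k} = (∇_{∂_k} T)(∂_i, ∂_j) = ∂_k T_{ij} - Γ^l_{ki} T_{lj} - Γ^l_{kj} T_{il}`
of a `(0,2)`-tensor. -/
def covDeriv (b : Module.Basis ι ℝ E) (G : E → Matrix ι ι ℝ) (T : ι → ι → E → ℝ)
    (i j k : ι) (y : E) : ℝ :=
  pd b k (T i j) y - ∑ l, christoffel b G l k i y * T l j y - ∑ l, christoffel b G l k j y * T i l y

end RiemCoord

/-! ## Curvature on a manifold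

`M` is a manifold without boundary modelled on `E`, and `g` a Riemannian metric on it.  In Mathlib
the tangent space `TangentSpace I p` is `E`, identified by means of the preferred chart
`extChartAt I p` at `p`; so the value at `p` of a tensor of `M` is the tensor on `E` whose
components at `p` are computed in that chart. -/

namespace Riem

variable {ι E H M : Type*} [Fintype ι] [DecidableEq ι] [NormedAddCommGroup E] [NormedSpace ℝ E]
  [TopologicalSpace H] [TopologicalSpace M] [ChartedSpace H M]

/-- The components `g_ij` of `g` in the preferred chart at `p`:
`g_ij(y) = g(∂_i, ∂_j)`, where `∂_i` is the image of the basis vector `b i` under the differential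
at `y` of the inverse of the chart. -/
def metricInChart (I : ModelWithCorners ℝ E H) (b : Module.Basis ι ℝ E)
    (g : ∀ p : M, TangentSpace I p → TangentSpace I p → ℝ) (p : M) (y : E) : Matrix ι ι ℝ :=
  Matrix.of fun i j =>
    g ((extChartAt I p).symm y)
      (mfderiv 𝓘(ℝ, E) I (extChartAt I p).symm y (b i))
      (mfderiv 𝓘(ℝ, E) I (extChartAt I p).symm y (b j))

/-- The Ricci curvature `Ric(X, Y)` for `X, Y ∈ T_p M`. -/
def ricci (I : ModelWithCorners ℝ E H) (b : Module.Basis ι ℝ E)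
    (g : ∀ p : M, TangentSpace I p → TangentSpace I p → ℝ) (p : M) (X Y : TangentSpace I p) : ℝ :=
  ∑ i, ∑ j, b.repr X i * b.repr Y j *
    RiemCoord.ricci b (metricInChart I b g p) i j (extChartAt I p p)

/-- The scalar curvature, a function on `M`. -/
def scalarCurvature (I : ModelWithCorners ℝ E H) (b : Module.Basis ι ℝ E)
    (g : ∀ p : M, TangentSpace I p → TangentSpace I p → ℝ) (p : M) : ℝ :=
  RiemCoord.scalar b (metricInChart I b g p) (extChartAt I p p)

/-- The trace-free Ricci tensor `Ric - (R / n) g`, where `n` is the dimension of `M`. -/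
def traceFreeRicci (I : ModelWithCorners ℝ E H) (b : Module.Basis ι ℝ E)
    (g : ∀ p : M, TangentSpace I p → TangentSpace I p → ℝ) (p : M) (X Y : TangentSpace I p) : ℝ :=
  ricci I b g p X Y - scalarCurvature I b g p / (Module.finrank ℝ E : ℝ) * g p X Y

/-- The Hessian `∇²f(X, Y)` for `X, Y ∈ T_p M`. -/
def hessian (I : ModelWithCorners ℝ E H) (b : Module.Basis ι ℝ E)
    (g : ∀ p : M, TangentSpace I p → TangentSpace I p → ℝ) (f : M → ℝ)
    (p : M) (X Y : TangentSpace I p) : ℝ :=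
  ∑ i, ∑ j, b.repr X i * b.repr Y j *
    RiemCoord.hessian b (metricInChart I b g p) (f ∘ (extChartAt I p).symm) i j (extChartAt I p p)

/-- The Laplace-Beltrami operator. -/
def laplacian (I : ModelWithCorners ℝ E H) (b : Module.Basis ι ℝ E)
    (g : ∀ p : M, TangentSpace I p → TangentSpace I p → ℝ) (f : M → ℝ) (p : M) : ℝ :=
  RiemCoord.laplacian b (metricInChart I b g p) (f ∘ (extChartAt I p).symm) (extChartAt I p p)

/-- The formal adjoint of the linearized scalar curvature,
`L*_g f = ∇²f - (Δf) g - f Ric`. -/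
def LStar (I : ModelWithCorners ℝ E H) (b : Module.Basis ι ℝ E)
    (g : ∀ p : M, TangentSpace I p → TangentSpace I p → ℝ) (f : M → ℝ)
    (p : M) (X Y : TangentSpace I p) : ℝ :=
  hessian I b g f p X Y - laplacian I b g f p * g p X Y - f p * ricci I b g p X Y

/-- The components, in the preferred chart at `p`, of the Schouten tensor
`A = Ric - R / (2 (n - 1)) g`; the scalar curvature `R` is a function on `M` and is read in the
chart. -/
def schoutenInChart (I : ModelWithCorners ℝ E H) (b : Module.Basis ι ℝ E)
    (g : ∀ p : M, TangentSpace I p → TangentSpace I p → ℝ) (p : M) (i j : ι) (y : E) : ℝ :=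
  RiemCoord.ricci b (metricInChart I b g p) i j y
    - scalarCurvature I b g ((extChartAt I p).symm y) / (2 * ((Module.finrank ℝ E : ℝ) - 1))
      * metricInChart I b g p y i j

/-- The Cotton tensor `C(X, Y, Z)` for `X, Y, Z ∈ T_p M`, with components
`C_{ijk} = A_{ij,k} - A_{ik,j}`; that is, `C(X, Y, Z) = (∇_Z A)(X, Y) - (∇_Y A)(X, Z)`. -/
def cotton (I : ModelWithCorners ℝ E H) (b : Module.Basis ι ℝ E)
    (g : ∀ p : M, TangentSpace I p → TangentSpace I p → ℝ)
    (p : M) (X Y Z : TangentSpace I p) : ℝ :=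
  ∑ i, ∑ j, ∑ k, b.repr X i * b.repr Y j * b.repr Z k *
    (RiemCoord.covDeriv b (metricInChart I b g p) (schoutenInChart I b g p)
        i j k (extChartAt I p p)
      - RiemCoord.covDeriv b (metricInChart I b g p) (schoutenInChart I b g p)
        i k j (extChartAt I p p))

end Riem

/-! ## Warped products over an open subset of the line

The fibre `N` has dimension `m`.  The product `J × N` carries Mathlib's product manifold structure;
its tangent space at `(t, x)` is `ℝ × T_x N`, and `(1, 0)` is `∂/∂t`. -/

namespace Warped

/-- The standard basis of the model space of the fibre. -/
def fiberBasis (m : ℕ) : Module.Basis (Fin m) ℝ (EuclideanSpace ℝ (Fin m)) :=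
  (EuclideanSpace.basisFun (Fin m) ℝ).toBasis

/-- The standard basis of the model space of the product. -/
def prodBasis (m : ℕ) : Module.Basis (Unit ⊕ Fin m) ℝ (ℝ × EuclideanSpace ℝ (Fin m)) :=
  (Module.Basis.singleton Unit ℝ).prod (fiberBasis m)

/-- The tangent vector `a ∂/∂t + v` at `p = (t, x)`, where `a ∈ ℝ` and `v ∈ T_x N`. -/
def tangentVector {m : ℕ} {N : Type*} [TopologicalSpace N]
    [ChartedSpace (EuclideanSpace ℝ (Fin m)) N] {J : TopologicalSpace.Opens ℝ}
    (p : J × N) (a : ℝ) (v : TangentSpace (𝓡 m) p.2) : TangentSpace (𝓘(ℝ, ℝ).prod (𝓡 m)) p :=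
  ((a, v) : ℝ × EuclideanSpace ℝ (Fin m))

/-- The warped product metric `g = dt ⊗ dt + h(t)² ḡ` on `J × N`. -/
def metric {m : ℕ} {N : Type*} [TopologicalSpace N] [ChartedSpace (EuclideanSpace ℝ (Fin m)) N]
    {J : TopologicalSpace.Opens ℝ} (h : ℝ → ℝ)
    (gN : ∀ x : N, TangentSpace (𝓡 m) x → TangentSpace (𝓡 m) x → ℝ)
    (p : J × N) (X Y : TangentSpace (𝓘(ℝ, ℝ).prod (𝓡 m)) p) : ℝ :=
  (X : ℝ × EuclideanSpace ℝ (Fin m)).1 * (Y : ℝ × EuclideanSpace ℝ (Fin m)).1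
    + h p.1 ^ 2 * gN p.2 (X : ℝ × EuclideanSpace ℝ (Fin m)).2 (Y : ℝ × EuclideanSpace ℝ (Fin m)).2

end Warped

end

/-!
The proof is a computation in the preferred chart at `p = (t, x)`, which is the product of the
inclusion of the interval with the preferred chart of the fibre at `x`.  In it the metric has the
block form `dt² + h(t)² K(z)`, where `K` is the metric of the fibre
(`Warped.isWarpedOn_metricInChart`).  Write `d = n - 1` for the dimension of the fibre, and `'` for
`d/dt`.  The only Christoffel symbols that are not zero are those of `K` together with
`Γ^t_{ij} = -h h' K_{ij}` and `Γ^k_{ti} = Γ^k_{it} = (h'/h) δ_{ki}`, whence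
* `Ric_tt = -d h''/h`, `Ric_ti = 0`, `Ric_ij = Ric(K)_ij - (h h'' + (d - 1) h'²) K_ij`;
* `R = (R(K) - 2 d h h'' - d (d - 1) h'²) / h²`.

With these formulas and those for the Hessian of a function of `t`, the tensor `L*(h')` has fibre
components `-h' Ric(K)_ij - (h² h''' + (d - 2) h h' h'' - (d - 1) h'³) K_ij` and no others
(`RiemCoord.IsWarpedOn.lStar_inr_inr`).

For the first claim, the Schouten tensor has no mixed components either, and it is a function of
`t` on `∂_t` and a combination `S_ij(z) + β(t) K_ij(z)` on the fibre.  The antisymmetrized covariant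
derivative of such a tensor in the direction `∂_t` is found in general
(`covDeriv_sub_covDeriv_inl`, `covDeriv_sub_covDeriv_inr`), and comparison with `L*(h')` gives
`RiemCoord.IsWarpedOn.lStar_eq_neg_cotton`.  Here the constancy of `R` ensures that no derivative of
`R` enters the Cotton tensor.

For the second claim, multiply the formula for `R` by `h²` and differentiate in `t`: as `R` is
constant and `R(K)` does not depend on `t`, this expresses `h'''` by lower derivatives, and the
coefficient of `K_ij` in `L*(h')` becomes `h' R(K) / d`
(`RiemCoord.IsWarpedOn.lStar_eq_neg_traceFree`).  The points `(t, x)` with `x` fixed suffice for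
this, and their preferred charts all induce the same chart of the fibre; no invariance of the
scalar curvature under a change of chart is needed.
-/

/-! ### Partial derivatives on a product with the line -/

namespace RiemCoord

variable {κ F : Type*} [NormedAddCommGroup F] [NormedSpace ℝ F]

/-- The basis of `ℝ × F` made of `∂/∂t` (index `inl ()`) and of the basis `c` of `F`. -/
noncomputable abbrev lineProdBasis (c : Module.Basis κ ℝ F) : Module.Basis (Unit ⊕ κ) ℝ (ℝ × F) :=
  (Module.Basis.singleton Unit ℝ).prod c

theorem pd_congr {ι E : Type*} [NormedAddCommGroup E] [NormedSpace ℝ E]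
    (b : Module.Basis ι ℝ E) (i : ι) {u v : E → ℝ} {y : E} (huv : u =ᶠ[nhds y] v) :
    pd b i u y = pd b i v y := by
  rw [pd, pd, huv.fderiv_eq]

theorem hasFDerivAt_fst_mul_snd {a : ℝ → ℝ} {w : F → ℝ} {t : ℝ} {z : F}
    (ha : DifferentiableAt ℝ a t) (hw : DifferentiableAt ℝ w z) :
    HasFDerivAt (fun y : ℝ × F => a y.1 * w y.2)
      (a t • ((fderiv ℝ w z).comp (ContinuousLinearMap.snd ℝ ℝ F))
        + w z • ((fderiv ℝ a t).comp (ContinuousLinearMap.fst ℝ ℝ F))) (t, z) := by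
  have h1 : HasFDerivAt (fun y : ℝ × F => a y.1)
      ((fderiv ℝ a t).comp (ContinuousLinearMap.fst ℝ ℝ F)) (t, z) :=
    ha.hasFDerivAt.comp (t, z) hasFDerivAt_fst
  have h2 : HasFDerivAt (fun y : ℝ × F => w y.2)
      ((fderiv ℝ w z).comp (ContinuousLinearMap.snd ℝ ℝ F)) (t, z) :=
    hw.hasFDerivAt.comp (t, z) hasFDerivAt_snd
  exact h1.mul h2

theorem pd_inl_fst_mul_snd (c : Module.Basis κ ℝ F) {a : ℝ → ℝ} {w : F → ℝ} {t : ℝ} {z : F}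
    (ha : DifferentiableAt ℝ a t) (hw : DifferentiableAt ℝ w z) :
    pd (lineProdBasis c) (Sum.inl ()) (fun y => a y.1 * w y.2) (t, z) = deriv a t * w z := by
  rw [pd, (hasFDerivAt_fst_mul_snd ha hw).fderiv]
  simp [mul_comm]

theorem pd_inr_fst_mul_snd (c : Module.Basis κ ℝ F) (i : κ) {a : ℝ → ℝ} {w : F → ℝ} {t : ℝ} {z : F}
    (ha : DifferentiableAt ℝ a t) (hw : DifferentiableAt ℝ w z) :
    pd (lineProdBasis c) (Sum.inr i) (fun y => a y.1 * w y.2) (t, z) = a t * pd c i w z := by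
  rw [pd, (hasFDerivAt_fst_mul_snd ha hw).fderiv]
  simp [pd]

variable [Fintype κ] [DecidableEq κ]

/-! ### Smoothness and symmetry of the Christoffel symbols -/

theorem contDiffOn_det {n : WithTop ℕ∞} {K : F → Matrix κ κ ℝ} {V : Set F}
    (hK : ∀ i j, ContDiffOn ℝ n (fun z => K z i j) V) :
    ContDiffOn ℝ n (fun z => (K z).det) V := by
  simp only [Matrix.det_apply']
  exact ContDiffOn.sum fun σ _ => contDiffOn_const.mul (contDiffOn_prod fun i _ => hK _ _)

theorem contDiffOn_invMetric {n : WithTop ℕ∞} {K : F → Matrix κ κ ℝ} {V : Set F}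
    (hK : ∀ i j, ContDiffOn ℝ n (fun z => K z i j) V) (hdet : ∀ z ∈ V, IsUnit (K z).det) (i j : κ) :
    ContDiffOn ℝ n (fun z => invMetric K z i j) V := by
  have h1 : ContDiffOn ℝ n (fun z => (K z).adjugate i j) V := by
    simp only [Matrix.adjugate_apply]
    refine contDiffOn_det fun k l => ?_
    by_cases hk : k = j
    · simp only [hk, Matrix.updateRow_self]
      exact contDiffOn_const
    · simp only [Matrix.updateRow_ne hk]
      exact hK k l
  refine (((contDiffOn_det hK).inv fun z hz => (hdet z hz).ne_zero).mul h1).congr fun z _ => ?_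
  simp [invMetric, Matrix.inv_def]

theorem contDiffOn_pd {ι E : Type*} [NormedAddCommGroup E] [NormedSpace ℝ E]
    (b : Module.Basis ι ℝ E) (i : ι) {u : E → ℝ} {V : Set E} (hV : IsOpen V)
    (hu : ContDiffOn ℝ ∞ u V) : ContDiffOn ℝ ∞ (pd b i u) V :=
  (hu.fderiv_of_isOpen hV (by simp)).clm_apply contDiffOn_const

theorem contDiffOn_christoffel (c : Module.Basis κ ℝ F) {K : F → Matrix κ κ ℝ} {V : Set F}
    (hV : IsOpen V) (hK : ∀ i j, ContDiffOn ℝ ∞ (fun z => K z i j) V)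
    (hdet : ∀ z ∈ V, IsUnit (K z).det) (k i j : κ) :
    ContDiffOn ℝ ∞ (christoffel c K k i j) V := by
  unfold christoffel
  refine contDiffOn_const.mul (ContDiffOn.sum fun l _ => (contDiffOn_invMetric hK hdet k l).mul ?_)
  exact ((contDiffOn_pd c i hV (hK j l)).add (contDiffOn_pd c j hV (hK i l))).sub
    (contDiffOn_pd c l hV (hK i j))

theorem contDiffOn_riemann (c : Module.Basis κ ℝ F) {K : F → Matrix κ κ ℝ} {V : Set F}
    (hV : IsOpen V) (hK : ∀ i j, ContDiffOn ℝ ∞ (fun z => K z i j) V)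
    (hdet : ∀ z ∈ V, IsUnit (K z).det) (l i j k : κ) :
    ContDiffOn ℝ ∞ (riemann c K l i j k) V := by
  unfold riemann
  have hΓ := contDiffOn_christoffel c hV hK hdet
  exact ((contDiffOn_pd c i hV (hΓ l j k)).sub (contDiffOn_pd c j hV (hΓ l i k))).add
    (ContDiffOn.sum fun s _ => ((hΓ l i s).mul (hΓ s j k)).sub ((hΓ l j s).mul (hΓ s i k)))

theorem contDiffOn_ricci (c : Module.Basis κ ℝ F) {K : F → Matrix κ κ ℝ} {V : Set F}
    (hV : IsOpen V) (hK : ∀ i j, ContDiffOn ℝ ∞ (fun z => K z i j) V)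
    (hdet : ∀ z ∈ V, IsUnit (K z).det) (j k : κ) :
    ContDiffOn ℝ ∞ (ricci c K j k) V :=
  ContDiffOn.sum fun i _ => contDiffOn_riemann c hV hK hdet i i j k

theorem christoffel_symm (c : Module.Basis κ ℝ F) {K : F → Matrix κ κ ℝ} {V : Set F}
    (hV : IsOpen V) (hK : ∀ z ∈ V, ∀ i j, K z i j = K z j i) (k i j : κ) {z : F} (hz : z ∈ V) :
    christoffel c K k i j z = christoffel c K k j i z := by
  unfold christoffel
  congr 1
  refine Finset.sum_congr rfl fun l _ => ?_
  have : pd c l (fun z => K z i j) z = pd c l (fun z => K z j i) z :=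
    pd_congr c l (Filter.eventuallyEq_of_mem (hV.mem_nhds hz) fun y hy => hK y hy i j)
  rw [this]
  ring

theorem riemann_self {ι E : Type*} [Fintype ι] [DecidableEq ι] [NormedAddCommGroup E]
    [NormedSpace ℝ E] (b : Module.Basis ι ℝ E) (G : E → Matrix ι ι ℝ) (l i k : ι) (y : E) :
    riemann b G l i i k y = 0 := by
  simp [riemann]

/-! ### Warped product metrics in coordinates -/

/-- On `J × V`, the metric `G` is the warped product metric `dt² + h(t)² K`, where `K` is a
smooth nondegenerate symmetric form on `V`. -/
structure IsWarpedOn (J : Set ℝ) (V : Set F) (h : ℝ → ℝ) (K : F → Matrix κ κ ℝ)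
    (G : ℝ × F → Matrix (Unit ⊕ κ) (Unit ⊕ κ) ℝ) : Prop where
  isOpen_base : IsOpen J
  isOpen_fiber : IsOpen V
  contDiffOn_warp : ContDiffOn ℝ ∞ h J
  pos : ∀ t ∈ J, 0 < h t
  contDiffOn_fiber : ∀ i j, ContDiffOn ℝ ∞ (fun z => K z i j) V
  symm : ∀ z ∈ V, ∀ i j, K z i j = K z j i
  isUnit_det : ∀ z ∈ V, IsUnit (K z).det
  eq_fromBlocks : ∀ t ∈ J, ∀ z ∈ V, G (t, z) = Matrix.fromBlocks 1 0 0 (h t ^ 2 • K z)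

namespace IsWarpedOn

variable {c : Module.Basis κ ℝ F} {J : Set ℝ} {V : Set F} {h : ℝ → ℝ} {K : F → Matrix κ κ ℝ}
  {G : ℝ × F → Matrix (Unit ⊕ κ) (Unit ⊕ κ) ℝ} {t : ℝ} {z : F}

theorem contDiffOn_deriv_warp (W : IsWarpedOn J V h K G) : ContDiffOn ℝ ∞ (deriv h) J :=
  W.contDiffOn_warp.deriv_of_isOpen W.isOpen_base (by simp)

theorem contDiffOn_deriv_deriv_warp (W : IsWarpedOn J V h K G) :
    ContDiffOn ℝ ∞ (deriv (deriv h)) J :=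
  W.contDiffOn_deriv_warp.deriv_of_isOpen W.isOpen_base (by simp)

theorem differentiableAt_base (W : IsWarpedOn J V h K G) (ht : t ∈ J) {a : ℝ → ℝ}
    (ha : ContDiffOn ℝ ∞ a J) : DifferentiableAt ℝ a t :=
  (ha.differentiableOn (by simp)).differentiableAt (W.isOpen_base.mem_nhds ht)

theorem differentiableAt_fiber (W : IsWarpedOn J V h K G) (hz : z ∈ V) {w : F → ℝ}
    (hw : ContDiffOn ℝ ∞ w V) : DifferentiableAt ℝ w z :=
  (hw.differentiableOn (by simp)).differentiableAt (W.isOpen_fiber.mem_nhds hz)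

theorem pd_congr (W : IsWarpedOn J V h K G) (ht : t ∈ J) (hz : z ∈ V)
    (i : Unit ⊕ κ) {u v : ℝ × F → ℝ} (huv : ∀ t ∈ J, ∀ z ∈ V, u (t, z) = v (t, z)) :
    pd (lineProdBasis c) i u (t, z) = pd (lineProdBasis c) i v (t, z) :=
  RiemCoord.pd_congr _ i (Filter.eventuallyEq_of_mem
    ((W.isOpen_base.prod W.isOpen_fiber).mem_nhds ⟨ht, hz⟩) fun y hy => huv y.1 hy.1 y.2 hy.2)

/-- The `t`-derivative of a function of the form `a(t) w(z)`.  Except for the fibre components of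
the Schouten tensor, every function differentiated below is of this form. -/
theorem pd_inl (W : IsWarpedOn J V h K G) (ht : t ∈ J) (hz : z ∈ V) {u : ℝ × F → ℝ}
    {a : ℝ → ℝ} {w : F → ℝ} (ha : DifferentiableAt ℝ a t) (hw : ContDiffOn ℝ ∞ w V)
    (hu : ∀ t ∈ J, ∀ z ∈ V, u (t, z) = a t * w z) :
    pd (lineProdBasis c) (Sum.inl ()) u (t, z) = deriv a t * w z := by
  rw [W.pd_congr ht hz _ (v := fun y => a y.1 * w y.2) hu,
    pd_inl_fst_mul_snd c ha (W.differentiableAt_fiber hz hw)]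

theorem pd_inr (W : IsWarpedOn J V h K G) (ht : t ∈ J) (hz : z ∈ V) (i : κ) {u : ℝ × F → ℝ}
    {a : ℝ → ℝ} {w : F → ℝ} (ha : DifferentiableAt ℝ a t) (hw : ContDiffOn ℝ ∞ w V)
    (hu : ∀ t ∈ J, ∀ z ∈ V, u (t, z) = a t * w z) :
    pd (lineProdBasis c) (Sum.inr i) u (t, z) = a t * pd c i w z := by
  rw [W.pd_congr ht hz _ (v := fun y => a y.1 * w y.2) hu,
    pd_inr_fst_mul_snd c i ha (W.differentiableAt_fiber hz hw)]

theorem pd_const (W : IsWarpedOn J V h K G) (ht : t ∈ J) (hz : z ∈ V) (i : Unit ⊕ κ)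
    {u : ℝ × F → ℝ} {r : ℝ} (hu : ∀ t ∈ J, ∀ z ∈ V, u (t, z) = r) :
    pd (lineProdBasis c) i u (t, z) = 0 := by
  rw [W.pd_congr ht hz i (v := fun _ => r) hu]
  simp [pd]

theorem pd_inr_base (W : IsWarpedOn J V h K G) (ht : t ∈ J) (hz : z ∈ V) (i : κ) {u : ℝ × F → ℝ}
    {a : ℝ → ℝ} (ha : DifferentiableAt ℝ a t) (hu : ∀ t ∈ J, ∀ z ∈ V, u (t, z) = a t) :
    pd (lineProdBasis c) (Sum.inr i) u (t, z) = 0 := by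
  rw [W.pd_inr ht hz i (w := fun _ => 1) ha contDiffOn_const (by simpa using hu)]
  simp [pd]

theorem pd_inl_base (W : IsWarpedOn J V h K G) (ht : t ∈ J) (hz : z ∈ V) {u : ℝ × F → ℝ}
    {a : ℝ → ℝ} (ha : DifferentiableAt ℝ a t) (hu : ∀ t ∈ J, ∀ z ∈ V, u (t, z) = a t) :
    pd (lineProdBasis c) (Sum.inl ()) u (t, z) = deriv a t := by
  rw [W.pd_inl ht hz (w := fun _ => 1) ha contDiffOn_const (by simpa using hu), mul_one]

theorem pd_inr_fiber (W : IsWarpedOn J V h K G) (ht : t ∈ J) (hz : z ∈ V) (i : κ)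
    {u : ℝ × F → ℝ} {w : F → ℝ} (hw : ContDiffOn ℝ ∞ w V)
    (hu : ∀ t ∈ J, ∀ z ∈ V, u (t, z) = w z) :
    pd (lineProdBasis c) (Sum.inr i) u (t, z) = pd c i w z := by
  rw [W.pd_inr ht hz i (a := fun _ => 1) (differentiableAt_const _) hw (by simpa using hu), one_mul]

theorem pd_inl_fiber (W : IsWarpedOn J V h K G) (ht : t ∈ J) (hz : z ∈ V)
    {u : ℝ × F → ℝ} {w : F → ℝ} (hw : ContDiffOn ℝ ∞ w V)
    (hu : ∀ t ∈ J, ∀ z ∈ V, u (t, z) = w z) :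
    pd (lineProdBasis c) (Sum.inl ()) u (t, z) = 0 := by
  rw [W.pd_inl ht hz (a := fun _ => 1) (differentiableAt_const _) hw (by simpa using hu)]
  simp

section Metric

variable (W : IsWarpedOn J V h K G) (ht : t ∈ J) (hz : z ∈ V)
include W ht hz

theorem apply_inl_inl : G (t, z) (Sum.inl ()) (Sum.inl ()) = 1 := by
  simp [W.eq_fromBlocks t ht z hz]

theorem apply_inl_inr (i : κ) : G (t, z) (Sum.inl ()) (Sum.inr i) = 0 := by
  simp [W.eq_fromBlocks t ht z hz]

theorem apply_inr_inl (i : κ) : G (t, z) (Sum.inr i) (Sum.inl ()) = 0 := by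
  simp [W.eq_fromBlocks t ht z hz]

theorem apply_inr_inr (i j : κ) : G (t, z) (Sum.inr i) (Sum.inr j) = h t ^ 2 * K z i j := by
  simp [W.eq_fromBlocks t ht z hz]

theorem invMetric_eq :
    invMetric G (t, z) = Matrix.fromBlocks 1 0 0 ((h t ^ 2)⁻¹ • invMetric K z) := by
  have hh : h t ^ 2 ≠ 0 := pow_ne_zero 2 (W.pos t ht).ne'
  rw [invMetric, W.eq_fromBlocks t ht z hz]
  refine Matrix.inv_eq_right_inv ?_
  rw [Matrix.fromBlocks_multiply, ← Matrix.fromBlocks_one]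
  simp [invMetric, Matrix.mul_nonsing_inv _ (W.isUnit_det z hz), smul_smul, hh]

omit ht in
theorem sum_invMetric_mul (k j : κ) : ∑ l, invMetric K z k l * K z j l = if k = j then 1 else 0 := by
  have := congrFun (congrFun (Matrix.nonsing_inv_mul _ (W.isUnit_det z hz)) k) j
  rw [Matrix.mul_apply, Matrix.one_apply] at this
  rw [← this]
  exact Finset.sum_congr rfl fun l _ => by rw [W.symm z hz j l]; rfl

theorem pd_inl_metric (i j : κ) :
    pd (lineProdBasis c) (Sum.inl ()) (fun y => G y (Sum.inr i) (Sum.inr j)) (t, z)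
      = 2 * h t * deriv h t * K z i j := by
  have hd := W.differentiableAt_base ht W.contDiffOn_warp
  rw [W.pd_inl ht hz (a := fun t => h t ^ 2) (hd.pow 2) (W.contDiffOn_fiber i j)
    fun _ ht _ hz => W.apply_inr_inr ht hz i j, deriv_fun_pow hd]
  simp

theorem pd_inr_metric (l i j : κ) :
    pd (lineProdBasis c) (Sum.inr l) (fun y => G y (Sum.inr i) (Sum.inr j)) (t, z)
      = h t ^ 2 * pd c l (fun z => K z i j) z :=
  W.pd_inr ht hz l (a := fun t => h t ^ 2)
    ((W.differentiableAt_base ht W.contDiffOn_warp).pow 2) (W.contDiffOn_fiber i j)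
    fun _ ht _ hz => W.apply_inr_inr ht hz i j

theorem pd_metric_inl_inl (i : Unit ⊕ κ) :
    pd (lineProdBasis c) i (fun y => G y (Sum.inl ()) (Sum.inl ())) (t, z) = 0 :=
  W.pd_const ht hz i fun _ ht _ hz => W.apply_inl_inl ht hz

theorem pd_metric_inl_inr (i : Unit ⊕ κ) (j : κ) :
    pd (lineProdBasis c) i (fun y => G y (Sum.inl ()) (Sum.inr j)) (t, z) = 0 :=
  W.pd_const ht hz i fun _ ht _ hz => W.apply_inl_inr ht hz j

theorem pd_metric_inr_inl (i : Unit ⊕ κ) (j : κ) :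
    pd (lineProdBasis c) i (fun y => G y (Sum.inr j) (Sum.inl ())) (t, z) = 0 :=
  W.pd_const ht hz i fun _ ht _ hz => W.apply_inr_inl ht hz j

end Metric

/-! ### Christoffel symbols -/

section Christoffel

variable (W : IsWarpedOn J V h K G) (ht : t ∈ J) (hz : z ∈ V)
include W ht hz

/-- `Γ^t_{ij} = -h h' K_ij`. -/
theorem christoffel_inl (i j : κ) :
    christoffel (lineProdBasis c) G (Sum.inl ()) (Sum.inr i) (Sum.inr j) (t, z)
      = -(h t * deriv h t) * K z i j := by
  simp only [christoffel, Fintype.sum_sum_type, Finset.univ_unique, PUnit.default_eq_unit,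
    Finset.sum_singleton, W.invMetric_eq ht hz, W.pd_inl_metric ht hz, W.pd_metric_inr_inl ht hz]
  simp
  ring

/-- `Γ^k_{ij}` is the Christoffel symbol of the fibre. -/
theorem christoffel_inr (k i j : κ) :
    christoffel (lineProdBasis c) G (Sum.inr k) (Sum.inr i) (Sum.inr j) (t, z)
      = christoffel c K k i j z := by
  have hh : h t ≠ 0 := (W.pos t ht).ne'
  simp only [christoffel, Fintype.sum_sum_type, Finset.univ_unique, PUnit.default_eq_unit,
    Finset.sum_singleton, W.invMetric_eq ht hz, W.pd_inr_metric ht hz, W.pd_metric_inr_inl ht hz]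
  simp
  refine Finset.sum_congr rfl fun l _ => ?_
  field_simp

theorem christoffel_inl_inl (k : Unit ⊕ κ) :
    christoffel (lineProdBasis c) G k (Sum.inl ()) (Sum.inl ()) (t, z) = 0 := by
  simp [christoffel, W.pd_metric_inl_inl ht hz, W.pd_metric_inl_inr ht hz]

theorem christoffel_inl_inl_inr (j : κ) :
    christoffel (lineProdBasis c) G (Sum.inl ()) (Sum.inl ()) (Sum.inr j) (t, z) = 0 := by
  simp [christoffel, W.invMetric_eq ht hz, W.pd_metric_inl_inl ht hz, W.pd_metric_inl_inr ht hz,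
    W.pd_metric_inr_inl ht hz]

theorem christoffel_inl_inr_inl (j : κ) :
    christoffel (lineProdBasis c) G (Sum.inl ()) (Sum.inr j) (Sum.inl ()) (t, z) = 0 := by
  simp [christoffel, W.invMetric_eq ht hz, W.pd_metric_inl_inl ht hz, W.pd_metric_inl_inr ht hz,
    W.pd_metric_inr_inl ht hz]

/-- `Γ^k_{tj} = (h'/h) δ_{kj}`. -/
theorem christoffel_inr_inl_inr (k j : κ) :
    christoffel (lineProdBasis c) G (Sum.inr k) (Sum.inl ()) (Sum.inr j) (t, z)
      = if k = j then deriv h t / h t else 0 := by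
  have hh : h t ≠ 0 := (W.pos t ht).ne'
  have h1 := W.sum_invMetric_mul hz k j
  have h2 : ∑ l, (h t ^ 2)⁻¹ * invMetric K z k l * (2 * h t * deriv h t * K z j l)
      = 2 * deriv h t / h t * ∑ l, invMetric K z k l * K z j l := by
    rw [Finset.mul_sum]
    refine Finset.sum_congr rfl fun l _ => ?_
    field_simp
  simp only [christoffel, Fintype.sum_sum_type, Finset.univ_unique, PUnit.default_eq_unit,
    Finset.sum_singleton, W.invMetric_eq ht hz, W.pd_inl_metric ht hz, W.pd_metric_inr_inl ht hz,
    W.pd_metric_inl_inr ht hz]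
  simp [h2, h1]
  split_ifs <;> ring

theorem christoffel_inr_inr_inl (k j : κ) :
    christoffel (lineProdBasis c) G (Sum.inr k) (Sum.inr j) (Sum.inl ()) (t, z)
      = if k = j then deriv h t / h t else 0 := by
  rw [← W.christoffel_inr_inl_inr (c := c) ht hz k j]
  simp only [christoffel, Fintype.sum_sum_type, W.pd_metric_inr_inl ht hz,
    W.pd_metric_inl_inr ht hz]
  simp [W.invMetric_eq ht hz]

end Christoffel

/-! ### Ricci and scalar curvature -/

section Ricci

variable (W : IsWarpedOn J V h K G) (ht : t ∈ J) (hz : z ∈ V)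
include W ht

theorem hasDerivAt_warp : HasDerivAt h (deriv h t) t :=
  (W.differentiableAt_base ht W.contDiffOn_warp).hasDerivAt

theorem hasDerivAt_deriv_warp : HasDerivAt (deriv h) (deriv (deriv h) t) t :=
  (W.differentiableAt_base ht W.contDiffOn_deriv_warp).hasDerivAt

theorem hasDerivAt_deriv_deriv_warp :
    HasDerivAt (deriv (deriv h)) (deriv (deriv (deriv h)) t) t :=
  (W.differentiableAt_base ht W.contDiffOn_deriv_deriv_warp).hasDerivAt

theorem hasDerivAt_logDeriv_warp :
    HasDerivAt (fun t => deriv h t / h t)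
      ((deriv (deriv h) t * h t - deriv h t * deriv h t) / h t ^ 2) t :=
  (W.hasDerivAt_deriv_warp ht).div (W.hasDerivAt_warp ht) (W.pos t ht).ne'

include hz

omit ht hz in
theorem contDiffOn_fiber_christoffel (k i j : κ) :
    ContDiffOn ℝ ∞ (christoffel c K k i j) V :=
  contDiffOn_christoffel c W.isOpen_fiber W.contDiffOn_fiber W.isUnit_det k i j

theorem pd_inl_christoffel_inl (j k : κ) :
    pd (lineProdBasis c) (Sum.inl ())
        (christoffel (lineProdBasis c) G (Sum.inl ()) (Sum.inr j) (Sum.inr k)) (t, z)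
      = -(deriv h t ^ 2 + h t * deriv (deriv h) t) * K z j k := by
  have hd : HasDerivAt (fun t => -(h t * deriv h t))
      (-(deriv h t * deriv h t + h t * deriv (deriv h) t)) t :=
    ((W.hasDerivAt_warp ht).mul (W.hasDerivAt_deriv_warp ht)).neg
  rw [W.pd_inl ht hz hd.differentiableAt (W.contDiffOn_fiber j k)
    fun t ht z hz => W.christoffel_inl (c := c) ht hz j k, hd.deriv]
  ring

theorem riemann_inl_inl_inr_inr (j k : κ) :
    riemann (lineProdBasis c) G (Sum.inl ()) (Sum.inl ()) (Sum.inr j) (Sum.inr k) (t, z)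
      = -(h t * deriv (deriv h) t) * K z j k := by
  have hh : h t ≠ 0 := (W.pos t ht).ne'
  rw [riemann, W.pd_inl_christoffel_inl ht hz,
    W.pd_const (r := 0) ht hz _ fun t ht z hz => W.christoffel_inl_inl_inr (c := c) ht hz k]
  simp [Fintype.sum_sum_type, W.christoffel_inl_inl ht hz, W.christoffel_inl_inl_inr ht hz,
    W.christoffel_inl ht hz, W.christoffel_inr_inl_inr ht hz, W.christoffel_inl_inr_inl ht hz]
  field_simp
  ring

theorem riemann_inl_inl_inr_inl (k : κ) :
    riemann (lineProdBasis c) G (Sum.inl ()) (Sum.inl ()) (Sum.inr k) (Sum.inl ()) (t, z) = 0 := by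
  rw [riemann,
    W.pd_const (r := 0) ht hz _ fun t ht z hz => W.christoffel_inl_inr_inl (c := c) ht hz k,
    W.pd_const (r := 0) ht hz _ fun t ht z hz => W.christoffel_inl_inl (c := c) ht hz _]
  simp [Fintype.sum_sum_type, W.christoffel_inl_inl ht hz, W.christoffel_inl_inl_inr ht hz]

theorem riemann_inr_inr_inl_inl (i : κ) :
    riemann (lineProdBasis c) G (Sum.inr i) (Sum.inr i) (Sum.inl ()) (Sum.inl ()) (t, z)
      = -(deriv (deriv h) t / h t) := by
  have hh : h t ≠ 0 := (W.pos t ht).ne'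
  rw [riemann,
    W.pd_const (r := 0) ht hz _ fun t ht z hz => W.christoffel_inl_inl (c := c) ht hz _,
    W.pd_inl_base ht hz (W.hasDerivAt_logDeriv_warp ht).differentiableAt
      fun t ht z hz => by rw [W.christoffel_inr_inr_inl (c := c) ht hz i i, if_pos rfl],
    (W.hasDerivAt_logDeriv_warp ht).deriv]
  simp [Fintype.sum_sum_type, W.christoffel_inl_inl ht hz,
    W.christoffel_inr_inl_inr ht hz, W.christoffel_inr_inr_inl ht hz]
  field_simp
  ring

theorem riemann_inr_inr_inl_inr (i k : κ) :
    riemann (lineProdBasis c) G (Sum.inr i) (Sum.inr i) (Sum.inl ()) (Sum.inr k) (t, z) = 0 := by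
  have hd : DifferentiableAt ℝ (fun t => if i = k then deriv h t / h t else 0) t := by
    split_ifs
    · exact (W.hasDerivAt_logDeriv_warp ht).differentiableAt
    · exact differentiableAt_const _
  rw [riemann,
    W.pd_inr_base ht hz _ hd fun t ht z hz => W.christoffel_inr_inl_inr (c := c) ht hz i k,
    W.pd_inl_fiber ht hz (W.contDiffOn_fiber_christoffel i i k)
      fun t ht z hz => W.christoffel_inr ht hz i i k]
  simp [Fintype.sum_sum_type, W.christoffel_inl_inl ht hz, W.christoffel_inl_inl_inr ht hz,
    W.christoffel_inr_inl_inr ht hz, W.christoffel_inr ht hz, mul_comm]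

theorem riemann_inr_inr_inr_inl (i k : κ) :
    riemann (lineProdBasis c) G (Sum.inr i) (Sum.inr i) (Sum.inr k) (Sum.inl ()) (t, z) = 0 := by
  have hd : DifferentiableAt ℝ (fun t => if i = k then deriv h t / h t else 0) t := by
    split_ifs
    · exact (W.hasDerivAt_logDeriv_warp ht).differentiableAt
    · exact differentiableAt_const _
  rw [riemann,
    W.pd_inr_base ht hz _ hd fun t ht z hz => W.christoffel_inr_inr_inl (c := c) ht hz i k,
    W.pd_inr_base ht hz _ (W.hasDerivAt_logDeriv_warp ht).differentiableAt
      fun t ht z hz => by rw [W.christoffel_inr_inr_inl (c := c) ht hz i i, if_pos rfl]]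
  simp [Fintype.sum_sum_type, W.christoffel_inl_inr_inl ht hz,
    W.christoffel_inr_inr_inl ht hz, W.christoffel_inr ht hz,
    christoffel_symm c W.isOpen_fiber W.symm i k i hz]

theorem riemann_inr_inr_inr_inr (i j k : κ) :
    riemann (lineProdBasis c) G (Sum.inr i) (Sum.inr i) (Sum.inr j) (Sum.inr k) (t, z)
      = riemann c K i i j k z - deriv h t ^ 2 * K z j k
        + (if i = j then deriv h t ^ 2 * K z i k else 0) := by
  have hh : h t ≠ 0 := (W.pos t ht).ne'
  rw [riemann,
    W.pd_inr_fiber ht hz _ (W.contDiffOn_fiber_christoffel i j k)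
      fun t ht z hz => W.christoffel_inr ht hz i j k,
    W.pd_inr_fiber ht hz _ (W.contDiffOn_fiber_christoffel i i k)
      fun t ht z hz => W.christoffel_inr ht hz i i k]
  simp only [Fintype.sum_sum_type, Finset.univ_unique, PUnit.default_eq_unit,
    Finset.sum_singleton, W.christoffel_inr_inr_inl ht hz, W.christoffel_inr ht hz,
    W.christoffel_inl ht hz, riemann]
  split_ifs <;> simp <;> field_simp <;> ring

/-- `Ric_tt = -d h''/h`, where `d` is the dimension of the fibre. -/
theorem ricci_inl_inl :
    ricci (lineProdBasis c) G (Sum.inl ()) (Sum.inl ()) (t, z)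
      = -(Fintype.card κ * (deriv (deriv h) t / h t)) := by
  simp [ricci, riemann_self, W.riemann_inr_inr_inl_inl ht hz]

theorem ricci_inl_inr (k : κ) :
    ricci (lineProdBasis c) G (Sum.inl ()) (Sum.inr k) (t, z) = 0 := by
  simp [ricci, riemann_self, W.riemann_inr_inr_inl_inr ht hz]

theorem ricci_inr_inl (k : κ) :
    ricci (lineProdBasis c) G (Sum.inr k) (Sum.inl ()) (t, z) = 0 := by
  simp [ricci, W.riemann_inl_inl_inr_inl ht hz, W.riemann_inr_inr_inr_inl ht hz]

/-- `Ric_jk = Ric(K)_jk - (h h'' + (d - 1) h'²) K_jk`, where `d` is the dimension of the fibre. -/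
theorem ricci_inr_inr (j k : κ) :
    ricci (lineProdBasis c) G (Sum.inr j) (Sum.inr k) (t, z)
      = ricci c K j k z
        - (h t * deriv (deriv h) t + (Fintype.card κ - 1) * deriv h t ^ 2) * K z j k := by
  simp [ricci, W.riemann_inl_inl_inr_inr ht hz, W.riemann_inr_inr_inr_inr ht hz,
    Finset.sum_add_distrib]
  ring

omit ht in
theorem sum_sum_invMetric_mul :
    ∑ i, ∑ j, invMetric K z i j * K z i j = Fintype.card κ := by
  simp [W.sum_invMetric_mul hz]

/-- The trace of a `(0,2)`-tensor that has no mixed components and whose fibre part is a combination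
of a tensor `S` of the fibre with the metric `K`. -/
theorem trace_eq {T : Unit ⊕ κ → Unit ⊕ κ → ℝ} {S : κ → κ → ℝ} {r : ℝ}
    (hT : ∀ i j, T (Sum.inr i) (Sum.inr j) = S i j + r * K z i j) :
    ∑ i, ∑ j, invMetric G (t, z) i j * T i j
      = T (Sum.inl ()) (Sum.inl ())
        + ((∑ i, ∑ j, invMetric K z i j * S i j) + r * Fintype.card κ) / h t ^ 2 := by
  rw [← W.sum_sum_invMetric_mul hz]
  simp only [W.invMetric_eq ht hz, Fintype.sum_sum_type, hT]
  simp [Finset.mul_sum, ← Finset.sum_add_distrib, Finset.sum_div]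
  refine Finset.sum_congr rfl fun i _ => Finset.sum_congr rfl fun j _ => ?_
  ring

/-- `R = (R(K) - 2 d h h'' - d (d - 1) h'²) / h²`, where `d` is the dimension of the fibre. -/
theorem scalar_eq :
    scalar (lineProdBasis c) G (t, z)
      = (scalar c K z - 2 * Fintype.card κ * (h t * deriv (deriv h) t)
        - Fintype.card κ * (Fintype.card κ - 1) * deriv h t ^ 2) / h t ^ 2 := by
  have hh : h t ≠ 0 := (W.pos t ht).ne'
  rw [scalar, W.trace_eq ht hz (S := fun i j => ricci c K i j z)
      (r := -(h t * deriv (deriv h) t + (Fintype.card κ - 1) * deriv h t ^ 2))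
      fun i j => by rw [W.ricci_inr_inr ht hz]; ring,
    W.ricci_inl_inl ht hz, scalar]
  field_simp
  ring

end Ricci

/-! ### The Hessian of a function of `t` -/

section Hessian

variable (W : IsWarpedOn J V h K G) (ht : t ∈ J) (hz : z ∈ V) {u : ℝ × F → ℝ} {a : ℝ → ℝ}
  (ha : ContDiffOn ℝ ∞ a J) (hu : ∀ t ∈ J, ∀ z ∈ V, u (t, z) = a t)
include W ht hz ha hu

theorem hessian_inl_inl :
    hessian (lineProdBasis c) G u (Sum.inl ()) (Sum.inl ()) (t, z) = deriv (deriv a) t := by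
  have ha' : ContDiffOn ℝ ∞ (deriv a) J := ha.deriv_of_isOpen W.isOpen_base (by simp)
  rw [hessian, W.pd_inl_base ht hz (W.differentiableAt_base ht ha')
    fun t ht z hz => W.pd_inl_base (c := c) ht hz (W.differentiableAt_base ht ha) hu]
  simp [W.christoffel_inl_inl ht hz]

theorem hessian_inl_inr (j : κ) :
    hessian (lineProdBasis c) G u (Sum.inl ()) (Sum.inr j) (t, z) = 0 := by
  have h0 : ∀ t ∈ J, ∀ z ∈ V, ∀ j, pd (lineProdBasis c) (Sum.inr j) u (t, z) = 0 :=
    fun t ht z hz j => W.pd_inr_base (c := c) ht hz j (W.differentiableAt_base ht ha) hu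
  rw [hessian, W.pd_const (r := 0) ht hz _ fun t ht z hz => h0 t ht z hz j]
  simp [W.christoffel_inl_inl_inr ht hz, h0 t ht z hz]

theorem hessian_inr_inl (j : κ) :
    hessian (lineProdBasis c) G u (Sum.inr j) (Sum.inl ()) (t, z) = 0 := by
  have ha' : ContDiffOn ℝ ∞ (deriv a) J := ha.deriv_of_isOpen W.isOpen_base (by simp)
  have h0 : ∀ t ∈ J, ∀ z ∈ V, ∀ j, pd (lineProdBasis c) (Sum.inr j) u (t, z) = 0 :=
    fun t ht z hz j => W.pd_inr_base (c := c) ht hz j (W.differentiableAt_base ht ha) hu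
  rw [hessian, W.pd_inr_base ht hz _ (W.differentiableAt_base ht ha')
    fun t ht z hz => W.pd_inl_base (c := c) ht hz (W.differentiableAt_base ht ha) hu]
  simp [W.christoffel_inl_inr_inl ht hz, h0 t ht z hz]

theorem hessian_inr_inr (i j : κ) :
    hessian (lineProdBasis c) G u (Sum.inr i) (Sum.inr j) (t, z)
      = h t * deriv h t * deriv a t * K z i j := by
  have h0 : ∀ t ∈ J, ∀ z ∈ V, ∀ j, pd (lineProdBasis c) (Sum.inr j) u (t, z) = 0 :=
    fun t ht z hz j => W.pd_inr_base (c := c) ht hz j (W.differentiableAt_base ht ha) hu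
  rw [hessian, W.pd_const (r := 0) ht hz _ fun t ht z hz => h0 t ht z hz j]
  simp [W.christoffel_inl ht hz, h0 t ht z hz,
    W.pd_inl_base ht hz (W.differentiableAt_base ht ha) hu]
  ring

theorem laplacian_eq :
    laplacian (lineProdBasis c) G u (t, z)
      = deriv (deriv a) t + Fintype.card κ * (deriv h t / h t) * deriv a t := by
  have hh : h t ≠ 0 := (W.pos t ht).ne'
  rw [laplacian, W.trace_eq ht hz (S := 0) (r := h t * deriv h t * deriv a t)
      fun i j => by rw [W.hessian_inr_inr ht hz ha hu]; simp,
    W.hessian_inl_inl ht hz ha hu]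
  simp
  field_simp

end Hessian

/-! ### The antisymmetrized covariant derivative of a block tensor -/

section Codazzi

variable (W : IsWarpedOn J V h K G) (ht : t ∈ J) (hz : z ∈ V)
  {T : Unit ⊕ κ → Unit ⊕ κ → ℝ × F → ℝ} {α β : ℝ → ℝ}
  (hα : DifferentiableAt ℝ α t)
  (h_tt : ∀ t ∈ J, ∀ z ∈ V, T (Sum.inl ()) (Sum.inl ()) (t, z) = α t)
  (h_ti : ∀ t ∈ J, ∀ z ∈ V, ∀ i, T (Sum.inl ()) (Sum.inr i) (t, z) = 0)
  (h_it : ∀ t ∈ J, ∀ z ∈ V, ∀ i, T (Sum.inr i) (Sum.inl ()) (t, z) = 0)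
include W ht hz h_ti h_it

include hα h_tt in
/-- A block tensor whose `∂_t ∂_t`-component depends only on `t` satisfies
`T_{tt,k} - T_{tk,t} = 0`. -/
theorem covDeriv_sub_covDeriv_inl (k : Unit ⊕ κ) :
    covDeriv (lineProdBasis c) G T (Sum.inl ()) (Sum.inl ()) k (t, z)
      - covDeriv (lineProdBasis c) G T (Sum.inl ()) k (Sum.inl ()) (t, z) = 0 := by
  rcases k with ⟨⟩ | k
  · exact sub_self _
  · rw [covDeriv, covDeriv, W.pd_inr_base ht hz k hα h_tt,
      W.pd_const (r := 0) ht hz _ fun t ht z hz => h_ti t ht z hz k]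
    simp [W.christoffel_inl_inr_inl ht hz, W.christoffel_inl_inl ht hz,
      W.christoffel_inl_inl_inr ht hz, h_ti t ht z hz, h_it t ht z hz]

include h_tt in
/-- `T_{it,k} - T_{ik,t}` for a block tensor with `T_tt = α(t)` and
`T_ij = S_ij(z) + β(t) K_ij(z)`.  The covariant derivatives of the fibre do not enter. -/
theorem covDeriv_sub_covDeriv_inr {S : κ → κ → F → ℝ} (hS : ∀ i j, ContDiffOn ℝ ∞ (S i j) V)
    (hβ : DifferentiableAt ℝ β t)
    (h_ij : ∀ t ∈ J, ∀ z ∈ V, ∀ i j,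
      T (Sum.inr i) (Sum.inr j) (t, z) = S i j z + β t * K z i j) (i k : κ) :
    covDeriv (lineProdBasis c) G T (Sum.inr i) (Sum.inl ()) (Sum.inr k) (t, z)
      - covDeriv (lineProdBasis c) G T (Sum.inr i) (Sum.inr k) (Sum.inl ()) (t, z)
      = deriv h t / h t * S i k z
        + (h t * deriv h t * α t + deriv h t / h t * β t - deriv β t) * K z i k := by
  have hpd : pd (lineProdBasis c) (Sum.inl ()) (T (Sum.inr i) (Sum.inr k)) (t, z)
      = deriv β t * K z i k := by
    have hS' := hasFDerivAt_fst_mul_snd (differentiableAt_const (1 : ℝ) (x := t))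
      (W.differentiableAt_fiber hz (hS i k))
    have hK' := hasFDerivAt_fst_mul_snd hβ (W.differentiableAt_fiber hz (W.contDiffOn_fiber i k))
    rw [W.pd_congr ht hz _ (v := fun y => 1 * S i k y.2 + β y.1 * K y.2 i k)
      fun t ht z hz => by rw [h_ij t ht z hz, one_mul], pd, (hS'.fun_add hK').fderiv]
    simp [mul_comm]
  rw [covDeriv, covDeriv, hpd, W.pd_const (r := 0) ht hz _ fun t ht z hz => h_it t ht z hz i]
  simp [W.christoffel_inl_inr_inl ht hz, W.christoffel_inr_inr_inl ht hz,
    W.christoffel_inl_inl_inr ht hz, W.christoffel_inr_inl_inr ht hz, W.christoffel_inl ht hz,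
    h_tt t ht z hz, h_ti t ht z hz, h_it t ht z hz, h_ij t ht z hz, W.symm z hz k i]
  ring

end Codazzi

/-! ### The adjoint of the linearized scalar curvature at the derivative of the warping function -/

section LStar

variable (W : IsWarpedOn J V h K G) (ht : t ∈ J) (hz : z ∈ V) {u : ℝ × F → ℝ}
  (hu : ∀ t ∈ J, ∀ z ∈ V, u (t, z) = deriv h t)
include W ht hz hu

theorem lStar_inl_left (k : Unit ⊕ κ) :
    hessian (lineProdBasis c) G u (Sum.inl ()) k (t, z)
      - laplacian (lineProdBasis c) G u (t, z) * G (t, z) (Sum.inl ()) k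
      - deriv h t * ricci (lineProdBasis c) G (Sum.inl ()) k (t, z) = 0 := by
  rcases k with ⟨⟩ | k
  · rw [W.hessian_inl_inl ht hz W.contDiffOn_deriv_warp hu,
      W.laplacian_eq ht hz W.contDiffOn_deriv_warp hu, W.apply_inl_inl ht hz,
      W.ricci_inl_inl ht hz]
    ring
  · rw [W.hessian_inl_inr ht hz W.contDiffOn_deriv_warp hu, W.apply_inl_inr ht hz,
      W.ricci_inl_inr ht hz]
    ring

theorem lStar_inr_inl (i : κ) :
    hessian (lineProdBasis c) G u (Sum.inr i) (Sum.inl ()) (t, z)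
      - laplacian (lineProdBasis c) G u (t, z) * G (t, z) (Sum.inr i) (Sum.inl ())
      - deriv h t * ricci (lineProdBasis c) G (Sum.inr i) (Sum.inl ()) (t, z) = 0 := by
  rw [W.hessian_inr_inl ht hz W.contDiffOn_deriv_warp hu, W.apply_inr_inl ht hz,
    W.ricci_inr_inl ht hz]
  ring

/-- The fibre components of `L*(h')`, for an arbitrary warping function. -/
theorem lStar_inr_inr (i k : κ) :
    hessian (lineProdBasis c) G u (Sum.inr i) (Sum.inr k) (t, z)
      - laplacian (lineProdBasis c) G u (t, z) * G (t, z) (Sum.inr i) (Sum.inr k)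
      - deriv h t * ricci (lineProdBasis c) G (Sum.inr i) (Sum.inr k) (t, z)
      = -(deriv h t * ricci c K i k z)
        - (h t ^ 2 * deriv (deriv (deriv h)) t
          + (Fintype.card κ - 2) * (h t * deriv h t * deriv (deriv h) t)
          - (Fintype.card κ - 1) * deriv h t ^ 3) * K z i k := by
  have hh : h t ≠ 0 := (W.pos t ht).ne'
  rw [W.hessian_inr_inr ht hz W.contDiffOn_deriv_warp hu,
    W.laplacian_eq ht hz W.contDiffOn_deriv_warp hu, W.apply_inr_inr ht hz, W.ricci_inr_inr ht hz]
  field_simp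
  ring

/-- In coordinates, `L*(h')(∂_i, ∂_k) = -C(∂_i, h ∂_t, ∂_k)`, the Cotton tensor being formed with
`A = Ric - (R / (2 (n - 1))) g` for a constant `R`. -/
theorem lStar_eq_neg_cotton {R : ℝ} (hd : Fintype.card κ ≠ 0)
    {T : Unit ⊕ κ → Unit ⊕ κ → ℝ × F → ℝ}
    (hT : ∀ i j y, T i j y = ricci (lineProdBasis c) G i j y - R / (2 * Fintype.card κ) * G y i j)
    (i k : Unit ⊕ κ) :
    hessian (lineProdBasis c) G u i k (t, z)
      - laplacian (lineProdBasis c) G u (t, z) * G (t, z) i k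
      - deriv h t * ricci (lineProdBasis c) G i k (t, z)
      = -(h t * (covDeriv (lineProdBasis c) G T i (Sum.inl ()) k (t, z)
        - covDeriv (lineProdBasis c) G T i k (Sum.inl ()) (t, z))) := by
  have hh : h t ≠ 0 := (W.pos t ht).ne'
  have hd' : (Fintype.card κ : ℝ) ≠ 0 := Nat.cast_ne_zero.2 hd
  set d : ℝ := (Fintype.card κ : ℝ) with hd_def
  have h1 := W.hasDerivAt_warp ht
  have h2 := W.hasDerivAt_deriv_warp ht
  have h3 := W.hasDerivAt_deriv_deriv_warp ht
  have h_tt : ∀ t ∈ J, ∀ z ∈ V, T (Sum.inl ()) (Sum.inl ()) (t, z)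
      = -(d * (deriv (deriv h) t / h t)) - R / (2 * d) := fun t ht z hz => by
    rw [hT, W.ricci_inl_inl ht hz, W.apply_inl_inl ht hz, mul_one]
  have h_ti : ∀ t ∈ J, ∀ z ∈ V, ∀ i, T (Sum.inl ()) (Sum.inr i) (t, z) = 0 := fun t ht z hz i => by
    rw [hT, W.ricci_inl_inr ht hz, W.apply_inl_inr ht hz]; ring
  have h_it : ∀ t ∈ J, ∀ z ∈ V, ∀ i, T (Sum.inr i) (Sum.inl ()) (t, z) = 0 := fun t ht z hz i => by
    rw [hT, W.ricci_inr_inl ht hz, W.apply_inr_inl ht hz]; ring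
  have hα : HasDerivAt (fun t => -(d * (deriv (deriv h) t / h t)) - R / (2 * d))
      (-(d * ((deriv (deriv (deriv h)) t * h t - deriv (deriv h) t * deriv h t) / h t ^ 2))) t :=
    (((h3.div h1 hh).const_mul d).neg).sub_const _
  rcases i with ⟨⟩ | i
  · rw [W.lStar_inl_left ht hz hu,
      W.covDeriv_sub_covDeriv_inl ht hz hα.differentiableAt h_tt h_ti h_it]
    ring
  rcases k with ⟨⟩ | k
  · rw [W.lStar_inr_inl ht hz hu]
    ring
  have hβ : HasDerivAt
      (fun t => -(h t * deriv (deriv h) t + (d - 1) * deriv h t ^ 2) - R / (2 * d) * h t ^ 2)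
      (-((deriv h t * deriv (deriv h) t + h t * deriv (deriv (deriv h)) t)
        + (d - 1) * (2 * deriv h t * deriv (deriv h) t))
        - R / (2 * d) * (2 * h t * deriv h t)) t := by
    have := ((h1.fun_mul h3).fun_add ((h2.fun_pow 2).const_mul (d - 1))).fun_neg.fun_sub
      ((h1.fun_pow 2).const_mul (R / (2 * d)))
    simpa using this
  rw [W.lStar_inr_inr ht hz hu, W.covDeriv_sub_covDeriv_inr ht hz h_tt h_ti h_it
    (S := fun i j => ricci c K i j)
    (contDiffOn_ricci c W.isOpen_fiber W.contDiffOn_fiber W.isUnit_det) hβ.differentiableAt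
    (fun t ht z hz i j => by rw [hT, W.ricci_inr_inr ht hz, W.apply_inr_inr ht hz]; ring),
    hβ.deriv]
  simp only [← hd_def]
  field_simp
  ring

/-- In coordinates, `L*(h')(∂_i, ∂_k) = -h' (Ric_N - (R_N / (n - 1)) g_N)(∂_i, ∂_k)` in the fibre
directions, as soon as the scalar curvature is constant along the line through the point.  The
coefficient of the metric is found by differentiating in `t` the formula `scalar_eq`, in which the
scalar curvature of the fibre does not depend on `t`. -/
theorem lStar_eq_neg_traceFree {R : ℝ} (hd : Fintype.card κ ≠ 0)
    (hR : ∀ t ∈ J, scalar (lineProdBasis c) G (t, z) = R) (i k : κ) :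
    hessian (lineProdBasis c) G u (Sum.inr i) (Sum.inr k) (t, z)
      - laplacian (lineProdBasis c) G u (t, z) * G (t, z) (Sum.inr i) (Sum.inr k)
      - deriv h t * ricci (lineProdBasis c) G (Sum.inr i) (Sum.inr k) (t, z)
      = -(deriv h t * (ricci c K i k z - scalar c K z / Fintype.card κ * K z i k)) := by
  have hd' : (Fintype.card κ : ℝ) ≠ 0 := Nat.cast_ne_zero.2 hd
  rw [W.lStar_inr_inr ht hz hu]
  set d : ℝ := (Fintype.card κ : ℝ) with hd_def
  have h1 := W.hasDerivAt_warp ht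
  have h2 := W.hasDerivAt_deriv_warp ht
  have h3 := W.hasDerivAt_deriv_deriv_warp ht
  have hN : ∀ t ∈ J, R * h t ^ 2 + 2 * d * (h t * deriv (deriv h) t)
      + d * (d - 1) * deriv h t ^ 2 = scalar c K z := fun t ht => by
    have hh : h t ≠ 0 := (W.pos t ht).ne'
    rw [← hR t ht, W.scalar_eq ht hz]
    simp only [← hd_def]
    field_simp
    ring
  have hder : HasDerivAt (fun t => R * h t ^ 2 + 2 * d * (h t * deriv (deriv h) t)
      + d * (d - 1) * deriv h t ^ 2)
      (R * (2 * h t * deriv h t)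
        + 2 * d * (deriv h t * deriv (deriv h) t + h t * deriv (deriv (deriv h)) t)
        + d * (d - 1) * (2 * deriv h t * deriv (deriv h) t)) t := by
    have := (((h1.fun_pow 2).const_mul R).fun_add ((h1.fun_mul h3).const_mul (2 * d))).fun_add
      ((h2.fun_pow 2).const_mul (d * (d - 1)))
    simpa using this
  have h0 := hder.unique ((hasDerivAt_const t (scalar c K z)).congr_of_eventuallyEq
    (Filter.eventuallyEq_of_mem (W.isOpen_base.mem_nhds ht) hN))
  -- `h0` is the `t`-derivative of the formula for `R`; it eliminates `h'''`.
  have hcoef : h t ^ 2 * deriv (deriv (deriv h)) t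
      + (d - 2) * (h t * deriv h t * deriv (deriv h) t) - (d - 1) * deriv h t ^ 3
      = -(deriv h t * (scalar c K z / d)) := by
    rw [← hN t ht]
    field_simp
    linear_combination (h t / 2) * h0
  rw [hcoef]
  ring

end LStar

end IsWarpedOn
end RiemCoord

/-! ### The metric of a Riemannian manifold in a chart -/

namespace Riem

/-- The Gram matrix of the image of a basis under an injective map is invertible. -/
theorem isUnit_det_gram {ι E : Type*} [Fintype ι] [DecidableEq ι] [NormedAddCommGroup E]
    [NormedSpace ℝ E] (b : Module.Basis ι ℝ E) (B : E →L[ℝ] E →L[ℝ] ℝ)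
    (hB : ∀ v, v ≠ 0 → 0 < B v v) (e : E →L[ℝ] E) (he : Function.Injective e) :
    IsUnit (Matrix.of fun i j => B (e (b i)) (e (b j))).det := by
  rw [isUnit_iff_ne_zero]
  intro h0
  obtain ⟨v, hv, hv0⟩ := Matrix.exists_mulVec_eq_zero_iff.2 h0
  have hzero : B (e (∑ i, v i • b i)) (e (∑ i, v i • b i)) = 0 := by
    have h1 : ∀ i, ∑ j, B (e (b i)) (e (b j)) * v j = 0 := fun i => congrFun hv0 i
    have h2 : ∑ i, v i * ∑ j, B (e (b i)) (e (b j)) * v j = 0 := by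
      simp [h1]
    rw [← h2]
    simp only [map_sum, map_smul, sum_apply, smul_apply, smul_eq_mul, Finset.mul_sum]
    rw [Finset.sum_comm]
    exact Finset.sum_congr rfl fun i _ => Finset.sum_congr rfl fun j _ => by ring
  have hsum : ∑ i, v i • b i = 0 := by
    by_contra hne
    exact (hB _ fun h => hne (he (h.trans (map_zero e).symm))).ne' hzero
  exact hv (funext fun i => Fintype.linearIndependent_iff.1 b.linearIndependent v hsum i)

section Chart

variable {ι E H M : Type*} [Fintype ι] [DecidableEq ι] [NormedAddCommGroup E] [NormedSpace ℝ E]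
  [TopologicalSpace H] [TopologicalSpace M] [ChartedSpace H M] {I : ModelWithCorners ℝ E H}
  [I.Boundaryless] [IsManifold I ∞ M]
  (g : Bundle.ContMDiffRiemannianMetric I ∞ E (fun x : M => TangentSpace I x))
  (b : Module.Basis ι ℝ E)

theorem contMDiffOn_mfderiv_extChartAt_symm (x : M) (v : E) :
    ContMDiffOn 𝓘(ℝ, E) I.tangent ∞
      (fun z : E => (⟨(extChartAt I x).symm z,
        mfderiv 𝓘(ℝ, E) I (extChartAt I x).symm z v⟩ : TangentBundle I M))
      (extChartAt I x).target := by
  have : IsManifold I 1 M := IsManifold.of_le (n := ∞) (by simp)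
  have hV : IsOpen (extChartAt I x).target := isOpen_extChartAt_target x
  have h1 : ContMDiffOn 𝓘(ℝ, E) I ∞ (extChartAt I x).symm (extChartAt I x).target :=
    contMDiffOn_extChartAt_symm x
  have h2 := h1.contMDiffOn_tangentMapWithin (m := ∞) (by simp) hV.uniqueMDiffOn
  have h3 : ContMDiffOn 𝓘(ℝ, E) 𝓘(ℝ, E).tangent ∞
      (fun z : E => (⟨z, v⟩ : TangentBundle 𝓘(ℝ, E) E)) (extChartAt I x).target :=
    contMDiffOn_vectorSpace_iff_contDiffOn.2 contDiffOn_const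
  refine (h2.comp h3 fun z hz => hz).congr fun z hz => ?_
  rw [Function.comp_apply, tangentMapWithin, mfderivWithin_of_isOpen hV hz]

omit [Fintype ι] [DecidableEq ι] in
theorem contDiffOn_metricInChart (x : M) (i j : ι) :
    ContDiffOn ℝ ∞ (fun z => metricInChart I b (fun x v w => g.inner x v w) x z i j)
      (extChartAt I x).target := by
  have : IsManifold I 1 M := IsManifold.of_le (n := ∞) (by simp)
  rw [← contMDiffOn_iff_contDiffOn]
  intro z hz
  have hv := fun v => contMDiffOn_mfderiv_extChartAt_symm (I := I) x v z hz
  have hb : ContMDiffWithinAt 𝓘(ℝ, E) I ∞ (extChartAt I x).symm (extChartAt I x).target z :=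
    contMDiffOn_extChartAt_symm x z hz
  have key : ContMDiffWithinAt 𝓘(ℝ, E) (I.prod 𝓘(ℝ)) ∞
      (fun z => Bundle.TotalSpace.mk' ℝ (E := Bundle.Trivial M ℝ) ((extChartAt I x).symm z)
        (g.inner ((extChartAt I x).symm z) (mfderiv 𝓘(ℝ, E) I (extChartAt I x).symm z (b i))
          (mfderiv 𝓘(ℝ, E) I (extChartAt I x).symm z (b j)))) (extChartAt I x).target z := by
    apply ContMDiffWithinAt.clm_bundle_apply₂ (F₁ := E) (F₂ := E)
    · exact ContMDiffAt.comp_contMDiffWithinAt z g.contMDiff.contMDiffAt hb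
    · exact hv (b i)
    · exact hv (b j)
  simp only [Bundle.contMDiffWithinAt_totalSpace] at key
  exact key.2

omit [Fintype ι] [DecidableEq ι] [I.Boundaryless] in
theorem metricInChart_symm (x : M) (z : E) (i j : ι) :
    metricInChart I b (fun x v w => g.inner x v w) x z i j
      = metricInChart I b (fun x v w => g.inner x v w) x z j i :=
  g.symm _ _ _

theorem isUnit_det_metricInChart (x : M) {z : E} (hz : z ∈ (extChartAt I x).target) :
    IsUnit (metricInChart I b (fun x v w => g.inner x v w) x z).det := by
  have : IsManifold I 1 M := IsManifold.of_le (n := ∞) (by simp)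
  have hinj : Function.Injective (mfderiv 𝓘(ℝ, E) I (extChartAt I x).symm z) := by
    have := isInvertible_mfderivWithin_extChartAt_symm (I := I) hz
    rw [I.range_eq_univ, mfderivWithin_univ] at this
    exact this.injective
  exact isUnit_det_gram b (g.inner _) (g.pos _) _ hinj

omit [Fintype ι] [DecidableEq ι] [IsManifold I ∞ M] in
/-- At the point itself, the components in the preferred chart are the values of the metric on the
basis, because the differential of that chart at its centre is the identity of `T_x M = E`. -/
theorem metricInChart_self [IsManifold I 1 M] (γ : ∀ p : M, TangentSpace I p → TangentSpace I p → ℝ)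
    (x : M) (i j : ι) :
    metricInChart I b γ x (extChartAt I x x) i j = γ x (b i) (b j) := by
  have h1 : ∀ v : E, (mfderiv 𝓘(ℝ, E) I (extChartAt I x).symm (extChartAt I x x) v : E) = v := by
    intro v
    have := mfderivWithin_range_extChartAt_symm (I := I) (x := x)
    rw [I.range_eq_univ, mfderivWithin_univ] at this
    exact congrArg (fun L => L v) this
  -- `γ q` and `γ x` have different types, so the equality of the base points is eliminated first.
  have h2 : ∀ (q : M), q = x → ∀ v w : E, γ q v w = γ x v w := by
    rintro q rfl v w
    rfl
  have h3 := h2 _ (extChartAt_to_inv (I := I) x) (b i) (b j)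
  rw [← h3]
  simp only [metricInChart, Matrix.of_apply]
  exact congrArg₂ (γ ((extChartAt I x).symm (extChartAt I x x))) (h1 (b i)) (h1 (b j))

end Chart
end Riem

/-! ### The product chart of a warped product -/

namespace Warped

section OpenInterval

variable {J : TopologicalSpace.Opens ℝ}

theorem extChartAt_opens_apply (s t : J) : extChartAt 𝓘(ℝ, ℝ) s t = (t : ℝ) := rfl

/-- Every chart of an open subset `J` of the line is the inclusion, with image all of `J`. -/
theorem extChartAt_opens_target (s : J) : (extChartAt 𝓘(ℝ, ℝ) s).target = (J : Set ℝ) := by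
  ext t
  constructor
  · intro ht
    have := (extChartAt 𝓘(ℝ, ℝ) s).right_inv ht
    rw [extChartAt_opens_apply] at this
    exact this ▸ ((extChartAt 𝓘(ℝ, ℝ) s).symm t).2
  · intro ht
    have hs : (⟨t, ht⟩ : J) ∈ (extChartAt 𝓘(ℝ, ℝ) s).source := by
      rw [extChartAt_source, TopologicalSpace.Opens.chartAt_eq]
      simp [chartAt_self_eq]
    exact (extChartAt 𝓘(ℝ, ℝ) s).map_source hs

theorem coe_extChartAt_opens_symm (s : J) {t : ℝ} (ht : t ∈ J) :
    (((extChartAt 𝓘(ℝ, ℝ) s).symm t : J) : ℝ) = t :=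
  (extChartAt 𝓘(ℝ, ℝ) s).right_inv ((extChartAt_opens_target s).symm ▸ ht)

theorem hasMFDerivAt_extChartAt_opens_symm (s : J) {t : ℝ} (ht : t ∈ J) :
    HasMFDerivAt 𝓘(ℝ, ℝ) 𝓘(ℝ, ℝ) (extChartAt 𝓘(ℝ, ℝ) s).symm t (ContinuousLinearMap.id ℝ ℝ) := by
  refine ⟨continuousAt_extChartAt_symm'' ((extChartAt_opens_target s).symm ▸ ht), ?_⟩
  refine ((hasFDerivAt_id t).congr_of_eventuallyEq ?_).hasFDerivWithinAt
  filter_upwards [J.isOpen.mem_nhds ht] with r hr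
  exact coe_extChartAt_opens_symm s hr

end OpenInterval

variable {m : ℕ} {N : Type*} [TopologicalSpace N] [ChartedSpace (EuclideanSpace ℝ (Fin m)) N]
  {J : TopologicalSpace.Opens ℝ}

theorem extChartAt_eq (p : J × N) :
    extChartAt (𝓘(ℝ, ℝ).prod (𝓡 m)) p
      = (extChartAt 𝓘(ℝ, ℝ) p.1).prod (extChartAt (𝓡 m) p.2) :=
  extChartAt_prod p

theorem extChartAt_apply_self (p : J × N) :
    extChartAt (𝓘(ℝ, ℝ).prod (𝓡 m)) p p = ((p.1 : ℝ), extChartAt (𝓡 m) p.2 p.2) := by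
  rw [extChartAt_eq]; rfl

theorem extChartAt_symm_apply (p : J × N) (y : ℝ × EuclideanSpace ℝ (Fin m)) :
    (extChartAt (𝓘(ℝ, ℝ).prod (𝓡 m)) p).symm y
      = ((extChartAt 𝓘(ℝ, ℝ) p.1).symm y.1, (extChartAt (𝓡 m) p.2).symm y.2) := by
  rw [extChartAt_eq]; rfl

variable [IsManifold (𝓡 m) ∞ N]

theorem hasMFDerivAt_extChartAt_symm (p : J × N) {t : ℝ} {z : EuclideanSpace ℝ (Fin m)}
    (ht : t ∈ J) (hz : z ∈ (extChartAt (𝓡 m) p.2).target) :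
    HasMFDerivAt 𝓘(ℝ, ℝ × EuclideanSpace ℝ (Fin m)) (𝓘(ℝ, ℝ).prod (𝓡 m))
      (fun y : ℝ × EuclideanSpace ℝ (Fin m) =>
        ((extChartAt 𝓘(ℝ, ℝ) p.1).symm y.1, (extChartAt (𝓡 m) p.2).symm y.2)) (t, z)
      (((ContinuousLinearMap.id ℝ ℝ).comp
          (ContinuousLinearMap.fst ℝ ℝ (EuclideanSpace ℝ (Fin m)))).prod
        ((mfderiv 𝓘(ℝ, EuclideanSpace ℝ (Fin m)) (𝓡 m) (extChartAt (𝓡 m) p.2).symm z).comp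
          (ContinuousLinearMap.snd ℝ ℝ (EuclideanSpace ℝ (Fin m))))) := by
  have : IsManifold (𝓡 m) 1 N := IsManifold.of_le (n := ∞) (by simp)
  have h1 : HasMFDerivAt 𝓘(ℝ, ℝ × EuclideanSpace ℝ (Fin m)) 𝓘(ℝ, ℝ)
      (fun y : ℝ × EuclideanSpace ℝ (Fin m) => y.1) (t, z)
      (ContinuousLinearMap.fst ℝ ℝ (EuclideanSpace ℝ (Fin m))) :=
    (hasFDerivAt_fst (𝕜 := ℝ) (p := (t, z))).hasMFDerivAt
  have h2 : HasMFDerivAt 𝓘(ℝ, ℝ × EuclideanSpace ℝ (Fin m)) 𝓘(ℝ, EuclideanSpace ℝ (Fin m))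
      (fun y : ℝ × EuclideanSpace ℝ (Fin m) => y.2) (t, z)
      (ContinuousLinearMap.snd ℝ ℝ (EuclideanSpace ℝ (Fin m))) :=
    (hasFDerivAt_snd (𝕜 := ℝ) (p := (t, z))).hasMFDerivAt
  have h3 : MDifferentiableAt 𝓘(ℝ, EuclideanSpace ℝ (Fin m)) (𝓡 m)
      (extChartAt (𝓡 m) p.2).symm z := by
    have := mdifferentiableWithinAt_extChartAt_symm (I := 𝓡 m) hz
    rwa [(𝓡 m).range_eq_univ, mdifferentiableWithinAt_univ] at this
  exact ((hasMFDerivAt_extChartAt_opens_symm p.1 ht).comp (t, z) h1).prodMk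
    (h3.hasMFDerivAt.comp (t, z) h2)

theorem mfderiv_extChartAt_symm (p : J × N) {t : ℝ} {z : EuclideanSpace ℝ (Fin m)}
    (ht : t ∈ J) (hz : z ∈ (extChartAt (𝓡 m) p.2).target)
    (v : ℝ × EuclideanSpace ℝ (Fin m)) :
    (mfderiv 𝓘(ℝ, ℝ × EuclideanSpace ℝ (Fin m)) (𝓘(ℝ, ℝ).prod (𝓡 m))
        (extChartAt (𝓘(ℝ, ℝ).prod (𝓡 m)) p).symm (t, z) v : ℝ × EuclideanSpace ℝ (Fin m))
      = (v.1, (mfderiv 𝓘(ℝ, EuclideanSpace ℝ (Fin m)) (𝓡 m) (extChartAt (𝓡 m) p.2).symm z v.2 :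
          EuclideanSpace ℝ (Fin m))) := by
  have h1 : ⇑(extChartAt (𝓘(ℝ, ℝ).prod (𝓡 m)) p).symm
      = fun y : ℝ × EuclideanSpace ℝ (Fin m) =>
        ((extChartAt 𝓘(ℝ, ℝ) p.1).symm y.1, (extChartAt (𝓡 m) p.2).symm y.2) :=
    funext (extChartAt_symm_apply p)
  rw [h1]
  exact congrArg (fun L => L v) (hasMFDerivAt_extChartAt_symm p ht hz).mfderiv

theorem metricInChart_apply (h : ℝ → ℝ)
    (γ : ∀ x : N, TangentSpace (𝓡 m) x → TangentSpace (𝓡 m) x → ℝ)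
    (p : J × N) {t : ℝ} {z : EuclideanSpace ℝ (Fin m)}
    (ht : t ∈ J) (hz : z ∈ (extChartAt (𝓡 m) p.2).target) (i j : Unit ⊕ Fin m) :
    Riem.metricInChart (𝓘(ℝ, ℝ).prod (𝓡 m)) (prodBasis m) (metric h γ) p (t, z) i j
      = (prodBasis m i).1 * (prodBasis m j).1 + h t ^ 2 *
        γ ((extChartAt (𝓡 m) p.2).symm z)
          (mfderiv 𝓘(ℝ, EuclideanSpace ℝ (Fin m)) (𝓡 m) (extChartAt (𝓡 m) p.2).symm z
            (prodBasis m i).2)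
          (mfderiv 𝓘(ℝ, EuclideanSpace ℝ (Fin m)) (𝓡 m) (extChartAt (𝓡 m) p.2).symm z
            (prodBasis m j).2) := by
  -- The two sides have different tangent spaces, so vectors are taken in the model space.
  have h1 : ∀ q q' : J × N, q = q' → ∀ v w : ℝ × EuclideanSpace ℝ (Fin m),
      metric h γ q v w = metric h γ q' v w := by
    rintro q _ rfl v w
    rfl
  have h2 : (extChartAt (𝓘(ℝ, ℝ).prod (𝓡 m)) p).symm (t, z)
      = (⟨t, ht⟩, (extChartAt (𝓡 m) p.2).symm z) := by
    rw [extChartAt_symm_apply]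
    exact Prod.ext (Subtype.ext (coe_extChartAt_opens_symm p.1 ht)) rfl
  have h3 := congrArg₂ (fun v w : ℝ × EuclideanSpace ℝ (Fin m) =>
      metric h γ (⟨t, ht⟩, (extChartAt (𝓡 m) p.2).symm z) v w)
    (mfderiv_extChartAt_symm p ht hz (prodBasis m i))
    (mfderiv_extChartAt_symm p ht hz (prodBasis m j))
  exact (h1 _ _ h2 _ _).trans h3

/-- In the preferred chart at `p`, the warped product metric is `dt² + h² K`, where `K` is the metric
of the fibre in its preferred chart at `p.2`. -/
theorem isWarpedOn_metricInChart {h : ℝ → ℝ} (h_smooth : ContDiffOn ℝ ∞ h J)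
    (h_pos : ∀ t ∈ J, 0 < h t)
    (gN : Bundle.ContMDiffRiemannianMetric (𝓡 m) ∞ (EuclideanSpace ℝ (Fin m))
      (fun x : N => TangentSpace (𝓡 m) x)) (p : J × N) :
    RiemCoord.IsWarpedOn (J : Set ℝ) (extChartAt (𝓡 m) p.2).target h
      (Riem.metricInChart (𝓡 m) (fiberBasis m) (fun x v w => gN.inner x v w) p.2)
      (Riem.metricInChart (𝓘(ℝ, ℝ).prod (𝓡 m)) (prodBasis m)
        (metric h (fun x v w => gN.inner x v w)) p) where
  isOpen_base := J.isOpen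
  isOpen_fiber := isOpen_extChartAt_target p.2
  contDiffOn_warp := h_smooth
  pos := h_pos
  contDiffOn_fiber := Riem.contDiffOn_metricInChart gN (fiberBasis m) p.2
  symm z _ := Riem.metricInChart_symm gN (fiberBasis m) p.2 z
  isUnit_det _ hz := Riem.isUnit_det_metricInChart gN (fiberBasis m) p.2 hz
  eq_fromBlocks t ht z hz := by
    ext i j
    rw [metricInChart_apply h _ p ht hz]
    -- Tangent spaces are replaced by the model space, so that linearity can be used.
    set γ : EuclideanSpace ℝ (Fin m) →L[ℝ] EuclideanSpace ℝ (Fin m) →L[ℝ] ℝ :=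
      gN.inner ((extChartAt (𝓡 m) p.2).symm z) with hγ
    set e : EuclideanSpace ℝ (Fin m) →L[ℝ] EuclideanSpace ℝ (Fin m) :=
      mfderiv 𝓘(ℝ, EuclideanSpace ℝ (Fin m)) (𝓡 m) (extChartAt (𝓡 m) p.2).symm z with he
    change _ + h t ^ 2 * γ (e _) (e _) = _
    rcases i with ⟨⟩ | i <;> rcases j with ⟨⟩ | j
    · simp [prodBasis]
    · simp [prodBasis]
    · simp [prodBasis]
    · simp only [prodBasis, Module.Basis.prod_apply_inr_fst, Module.Basis.prod_apply_inr_snd,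
        Matrix.fromBlocks_apply₂₂, Matrix.smul_apply, smul_eq_mul, mul_zero, zero_add]
      rfl

/-! ### Tensors of the warped product in terms of their components -/

theorem sum_repr_mul_repr_mul {ι E : Type*} [Fintype ι] [NormedAddCommGroup E] [NormedSpace ℝ E]
    (b : Module.Basis ι ℝ E) (B : E →L[ℝ] E →L[ℝ] ℝ) (v w : E) :
    ∑ i, ∑ j, b.repr v i * b.repr w j * B (b i) (b j) = B v w := by
  conv_rhs => rw [← b.sum_repr v, ← b.sum_repr w]
  simp only [map_sum, map_smul, sum_apply, smul_apply, smul_eq_mul, Finset.mul_sum]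
  rw [Finset.sum_comm]
  exact Finset.sum_congr rfl fun i _ => Finset.sum_congr rfl fun j _ => by ring

variable {h : ℝ → ℝ}
  (h_smooth : ContDiffOn ℝ ∞ h J) (h_pos : ∀ t ∈ J, 0 < h t)
  (gN : Bundle.ContMDiffRiemannianMetric (𝓡 m) ∞ (EuclideanSpace ℝ (Fin m))
    (fun x : N => TangentSpace (𝓡 m) x))

theorem finrank_model : Module.finrank ℝ (ℝ × EuclideanSpace ℝ (Fin m)) = m + 1 := by
  simp [add_comm]

include h_smooth h_pos in
theorem metric_eq_sum (p : J × N) (X Y : TangentSpace (𝓘(ℝ, ℝ).prod (𝓡 m)) p) :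
    metric h (fun x v w => gN.inner x v w) p X Y
      = ∑ i, ∑ j, (prodBasis m).repr X i * (prodBasis m).repr Y j *
        Riem.metricInChart (𝓘(ℝ, ℝ).prod (𝓡 m)) (prodBasis m)
          (metric h (fun x v w => gN.inner x v w)) p (p.1, extChartAt (𝓡 m) p.2 p.2) i j := by
  have : IsManifold (𝓡 m) 1 N := IsManifold.of_le (n := ∞) (by simp)
  have W := isWarpedOn_metricInChart h_smooth h_pos gN p
  have ht : (p.1 : ℝ) ∈ (J : Set ℝ) := p.1.2
  have hz := mem_extChartAt_target (I := 𝓡 m) p.2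
  obtain ⟨a, v⟩ : ℝ × EuclideanSpace ℝ (Fin m) := X
  obtain ⟨r, w⟩ : ℝ × EuclideanSpace ℝ (Fin m) := Y
  have hN := sum_repr_mul_repr_mul (fiberBasis m) (gN.inner p.2) v w
  simp only [Fintype.sum_sum_type, W.apply_inr_inr ht hz, W.apply_inl_inl ht hz,
    W.apply_inl_inr ht hz, W.apply_inr_inl ht hz, Riem.metricInChart_self, Finset.univ_unique,
    PUnit.default_eq_unit, Finset.sum_singleton]
  refine (congrArg (fun s => a * r + h p.1 ^ 2 * s) hN.symm).trans ?_
  simp [prodBasis, Finset.mul_sum]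
  exact Finset.sum_congr rfl fun i _ => Finset.sum_congr rfl fun j _ => mul_left_comm _ _ _

/-- The components of `L*(h')` at `p = (t, x)`, in the preferred chart at `p`; the point `p` has
coordinates `(t, φ(x))` there, where `φ` is the preferred chart of the fibre at `x`. -/
noncomputable def lStarComponent (h : ℝ → ℝ)
    (g : ∀ p : J × N, TangentSpace (𝓘(ℝ, ℝ).prod (𝓡 m)) p →
      TangentSpace (𝓘(ℝ, ℝ).prod (𝓡 m)) p → ℝ) (p : J × N) (i j : Unit ⊕ Fin m) : ℝ :=
  RiemCoord.hessian (prodBasis m) (Riem.metricInChart (𝓘(ℝ, ℝ).prod (𝓡 m)) (prodBasis m) g p)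
      ((fun q : J × N => deriv h q.1) ∘ (extChartAt (𝓘(ℝ, ℝ).prod (𝓡 m)) p).symm) i j
      (p.1, extChartAt (𝓡 m) p.2 p.2)
    - RiemCoord.laplacian (prodBasis m)
        (Riem.metricInChart (𝓘(ℝ, ℝ).prod (𝓡 m)) (prodBasis m) g p)
        ((fun q : J × N => deriv h q.1) ∘ (extChartAt (𝓘(ℝ, ℝ).prod (𝓡 m)) p).symm)
        (p.1, extChartAt (𝓡 m) p.2 p.2)
      * Riem.metricInChart (𝓘(ℝ, ℝ).prod (𝓡 m)) (prodBasis m) g p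
        (p.1, extChartAt (𝓡 m) p.2 p.2) i j
    - deriv h p.1 * RiemCoord.ricci (prodBasis m)
        (Riem.metricInChart (𝓘(ℝ, ℝ).prod (𝓡 m)) (prodBasis m) g p) i j
        (p.1, extChartAt (𝓡 m) p.2 p.2)

include h_smooth h_pos in
theorem lStar_eq_sum (p : J × N) (X Y : TangentSpace (𝓘(ℝ, ℝ).prod (𝓡 m)) p) :
    Riem.LStar (𝓘(ℝ, ℝ).prod (𝓡 m)) (prodBasis m) (metric h (fun x v w => gN.inner x v w))
        (fun q => deriv h q.1) p X Y
      = ∑ i, ∑ j, (prodBasis m).repr X i * (prodBasis m).repr Y j *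
        lStarComponent h (metric h (fun x v w => gN.inner x v w)) p i j := by
  rw [Riem.LStar, Riem.hessian, Riem.ricci, Riem.laplacian, extChartAt_apply_self,
    metric_eq_sum h_smooth h_pos]
  simp only [lStarComponent, Finset.mul_sum, ← Finset.sum_sub_distrib]
  refine Finset.sum_congr rfl fun i _ => Finset.sum_congr rfl fun j _ => ?_
  ring

omit [IsManifold (𝓡 m) ∞ N] in
theorem repr_tangentVector_base (p : J × N) (a : ℝ) (j : Unit ⊕ Fin m) :
    (prodBasis m).repr (tangentVector p a 0) j = if j = Sum.inl () then a else 0 := by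
  rcases j with ⟨⟩ | j
  · simp [prodBasis, tangentVector]
  · simp [prodBasis, tangentVector]
    rfl

omit [IsManifold (𝓡 m) ∞ N] in
theorem comp_extChartAt_symm (p : J × N) (f : ℝ → ℝ) :
    ∀ t ∈ (J : Set ℝ), ∀ z ∈ (extChartAt (𝓡 m) p.2).target,
      ((fun q : J × N => f q.1) ∘ (extChartAt (𝓘(ℝ, ℝ).prod (𝓡 m)) p).symm) (t, z) = f t := by
  intro t ht z _
  rw [Function.comp_apply, extChartAt_symm_apply, coe_extChartAt_opens_symm p.1 ht]

include h_smooth h_pos in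
theorem lStar_eq_neg_cotton (hm : m ≠ 0) {R : ℝ}
    (hR : ∀ p : J × N, Riem.scalarCurvature (𝓘(ℝ, ℝ).prod (𝓡 m)) (prodBasis m)
      (metric h (fun x v w => gN.inner x v w)) p = R)
    (p : J × N) (X Y : TangentSpace (𝓘(ℝ, ℝ).prod (𝓡 m)) p) :
    Riem.LStar (𝓘(ℝ, ℝ).prod (𝓡 m)) (prodBasis m) (metric h (fun x v w => gN.inner x v w))
        (fun q => deriv h q.1) p X Y
      = -Riem.cotton (𝓘(ℝ, ℝ).prod (𝓡 m)) (prodBasis m)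
        (metric h (fun x v w => gN.inner x v w)) p X (tangentVector p (h p.1) 0) Y := by
  have W := isWarpedOn_metricInChart h_smooth h_pos gN p
  have key := fun i j => W.lStar_eq_neg_cotton (c := fiberBasis m) p.1.2
    (mem_extChartAt_target (I := 𝓡 m) p.2) (comp_extChartAt_symm p (deriv h)) (R := R)
    (T := Riem.schoutenInChart (𝓘(ℝ, ℝ).prod (𝓡 m)) (prodBasis m)
      (metric h (fun x v w => gN.inner x v w)) p) (by simpa using hm)
    (fun i j y => by
      rw [Riem.schoutenInChart, hR, finrank_model, Fintype.card_fin]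
      push_cast
      rw [add_sub_cancel_right]
      rfl) i j
  rw [lStar_eq_sum h_smooth h_pos, Riem.cotton, extChartAt_apply_self, ← Finset.sum_neg_distrib]
  refine Finset.sum_congr rfl fun i _ => ?_
  simp only [repr_tangentVector_base]
  rw [Finset.sum_comm, ← Finset.sum_neg_distrib]
  refine Finset.sum_congr rfl fun k _ => ?_
  rw [show lStarComponent h (metric h (fun x v w => gN.inner x v w)) p i k = _ from key i k]
  simp [prodBasis]
  ring

include h_smooth h_pos in
theorem lStar_eq_neg_traceFreeRicci (hm : m ≠ 0) {R : ℝ}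
    (hR : ∀ p : J × N, Riem.scalarCurvature (𝓘(ℝ, ℝ).prod (𝓡 m)) (prodBasis m)
      (metric h (fun x v w => gN.inner x v w)) p = R)
    (p : J × N) (v w : TangentSpace (𝓡 m) p.2) :
    Riem.LStar (𝓘(ℝ, ℝ).prod (𝓡 m)) (prodBasis m) (metric h (fun x v w => gN.inner x v w))
        (fun q => deriv h q.1) p (tangentVector p 0 v) (tangentVector p 0 w)
      = -(deriv h p.1 * Riem.traceFreeRicci (𝓡 m) (fiberBasis m)
          (fun x v w => gN.inner x v w) p.2 v w) := by
  have : IsManifold (𝓡 m) 1 N := IsManifold.of_le (n := ∞) (by simp)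
  have W := isWarpedOn_metricInChart h_smooth h_pos gN p
  have hz := mem_extChartAt_target (I := 𝓡 m) p.2
  have hR' : ∀ t ∈ (J : Set ℝ), RiemCoord.scalar (prodBasis m)
      (Riem.metricInChart (𝓘(ℝ, ℝ).prod (𝓡 m)) (prodBasis m)
        (metric h (fun x v w => gN.inner x v w)) p) (t, extChartAt (𝓡 m) p.2 p.2) = R := by
    intro t ht
    -- The charts at `p` and at `(t, p.2)` have the same second factor, so both scalar curvatures
    -- are given by `scalar_eq` with the same fibre metric.
    have W' := isWarpedOn_metricInChart h_smooth h_pos gN ((⟨t, ht⟩, p.2) : J × N)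
    have h1 := hR (⟨t, ht⟩, p.2)
    rw [Riem.scalarCurvature, extChartAt_apply_self] at h1
    exact ((W.scalar_eq (c := fiberBasis m) ht hz).trans
      (W'.scalar_eq (c := fiberBasis m) ht hz).symm).trans h1
  have key := fun i j => W.lStar_eq_neg_traceFree (c := fiberBasis m) p.1.2 hz
    (comp_extChartAt_symm p (deriv h)) (by simpa using hm) hR' i j
  have hN : ∑ i, ∑ j, (fiberBasis m).repr v i * (fiberBasis m).repr w j *
      gN.inner p.2 (fiberBasis m i) (fiberBasis m j) = gN.inner p.2 v w :=
    sum_repr_mul_repr_mul (fiberBasis m) (gN.inner p.2) v w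
  have hl : ∀ v : TangentSpace (𝓡 m) p.2,
      (prodBasis m).repr (tangentVector p 0 v) (Sum.inl ()) = 0 := fun v => by
    simp [prodBasis, tangentVector]
  have hr : ∀ (v : TangentSpace (𝓡 m) p.2) (i : Fin m),
      (prodBasis m).repr (tangentVector p 0 v) (Sum.inr i) = (fiberBasis m).repr v i :=
    fun v i => by
      simp [prodBasis, tangentVector]
  rw [lStar_eq_sum h_smooth h_pos, Riem.traceFreeRicci, Riem.ricci, Riem.scalarCurvature,
    finrank_euclideanSpace_fin]
  beta_reduce
  rw [← hN]
  simp only [Fintype.sum_sum_type, Finset.univ_unique, PUnit.default_eq_unit,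
    hl, hr, zero_mul, mul_zero, Finset.sum_const_zero, zero_add]
  simp only [Finset.mul_sum, ← Finset.sum_sub_distrib, ← Finset.sum_neg_distrib]
  refine Finset.sum_congr rfl fun i _ => Finset.sum_congr rfl fun j _ => ?_
  rw [show lStarComponent h (metric h (fun x v w => gN.inner x v w)) p (Sum.inr i) (Sum.inr j) = _
    from key i j, Riem.metricInChart_self, Fintype.card_fin]
  ring

end Warped

theorem mainTheorem5 (n : ℕ) (hn : 3 ≤ n)
    -- the open interval and the warping function
    (J : TopologicalSpace.Opens ℝ) (hJ : (J : Set ℝ).OrdConnected)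
    (h : ℝ → ℝ) (h_smooth : ContDiffOn ℝ ∞ h J) (h_pos : ∀ t ∈ J, 0 < h t)
    -- the fibre, a Riemannian manifold of dimension `n - 1`
    (N : Type*) [TopologicalSpace N] [ChartedSpace (EuclideanSpace ℝ (Fin (n - 1))) N]
    [IsManifold (𝓡 (n - 1)) ∞ N]
    (gN : Bundle.ContMDiffRiemannianMetric (𝓡 (n - 1)) ∞ (EuclideanSpace ℝ (Fin (n - 1)))
      (fun x : N => TangentSpace (𝓡 (n - 1)) x))
    -- the warped product metric, with constant scalar curvature
    (g : ∀ p : J × N, TangentSpace (𝓘(ℝ, ℝ).prod (𝓡 (n - 1))) p →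
      TangentSpace (𝓘(ℝ, ℝ).prod (𝓡 (n - 1))) p → ℝ)
    (hg : g = Warped.metric h (fun x v w => gN.inner x v w))
    (hR : ∃ R : ℝ, ∀ p : J × N,
      Riem.scalarCurvature (𝓘(ℝ, ℝ).prod (𝓡 (n - 1))) (Warped.prodBasis (n - 1)) g p = R) :
    (∀ (p : J × N) (X Y : TangentSpace (𝓘(ℝ, ℝ).prod (𝓡 (n - 1))) p),
      Riem.LStar (𝓘(ℝ, ℝ).prod (𝓡 (n - 1))) (Warped.prodBasis (n - 1)) g
          (fun q => deriv h q.1) p X Y =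
        - Riem.cotton (𝓘(ℝ, ℝ).prod (𝓡 (n - 1))) (Warped.prodBasis (n - 1)) g p
            X (Warped.tangentVector p (h p.1) 0) Y) ∧
    (∀ (p : J × N) (v w : TangentSpace (𝓡 (n - 1)) p.2),
      Riem.LStar (𝓘(ℝ, ℝ).prod (𝓡 (n - 1))) (Warped.prodBasis (n - 1)) g
          (fun q => deriv h q.1) p (Warped.tangentVector p 0 v) (Warped.tangentVector p 0 w) =
        - (deriv h p.1 *
            Riem.traceFreeRicci (𝓡 (n - 1)) (Warped.fiberBasis (n - 1))
              (fun x v w => gN.inner x v w) p.2 v w)) := by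
  subst hg
  obtain ⟨R, hR⟩ := hR
  exact ⟨fun p X Y => Warped.lStar_eq_neg_cotton h_smooth h_pos gN (by omega) hR p X Y,
    fun p v w => Warped.lStar_eq_neg_traceFreeRicci h_smooth h_pos gN (by omega) hR p v w⟩
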